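/- **Setting.** Let $D\ge 1$, $d=D+1$, $m>0$, $\omega_{\mathbf p}=\sqrt{m^2+\mathbf p^2}$ and $\mathrm d\mu(\mathbf p)=\frac{1}{2\omega_{\mathbf p}}\frac{\mathrm d^D\mathbf p}{(2\pi)^D}$ on $\mathbb R^D$. For a Schwartz function $h\in\mathcal S(\mathbb R^d)$ (complex-valued) put $\tilde h(k^0,\mathbf k)=\int h(x)\,e^{-\mathrm i(-k^0x^0+\mathbf k\cdot\mathbf x)}\,\mathrm d^dx$. Let $\mathcal F=\bigoplus_{n\ge0}L^2_{\mathrm{sym}}((\mathbb R^D)^n,\mu^{\otimes n})$ be the symmetric Fock space over $L^2(\mathbb R^D,\mu)$, with annihilation and creation operators $a(\mathbf p),a^\dagger(\mathbf p)$, $[a(\mathbf p),a^\dagger(\mathbf q)]\,\mathrm d\mu(\mathbf p)=\delta(\mathbf p-\mathbf q)\,\mathrm d^D\mathbf p$, and let $\mathcal F_0\subset\mathcal F$ be the subspace of vectors with only finitely many non-zero $n$-particle components; $\psi$ contains at most $n$ particles if $\psi^{(l)}=0$ for all $l>n$. The complexified one-particle space $\mathcal H$ consists of the pairs $f=(f_+,f_-)$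 with $f_\pm\in L^2(\mathbb R^D,\mu)$; a Schwartz function $f$ on $\mathbb R^d$ is identified with $f_\pm(\mathbf p)=\tilde f(\pm\omega_{\mathbf p},\pm\mathbf p)$, and $f\in\mathcal H$ is called real if $f_-=\overline{f_+}$. On $\mathcal F_0$ define, for $f\in\mathcal H$ and $h\in\mathcal S(\mathbb R^d)$, $$\Phi(f)=\frac1{\sqrt2}\int\bigl[f_-(\mathbf p)\,a(\mathbf p)+f_+(\mathbf p)\,a^\dagger(\mathbf p)\bigr]\mathrm d\mu(\mathbf p),$$ $$:\!\Phi^2\!:\!(h)=\frac12\iint\bigl[\tilde h(-\omega_{\mathbf p}-\omega_{\mathbf q},-\mathbf p-\mathbf q)\,a(\mathbf p)a(\mathbf q)+2\tilde h(\omega_{\mathbf p}-\omega_{\mathbf q},\mathbf p-\mathbf q)\,a^\dagger(\mathbf p)a(\mathbf q)+\tilde h(\omega_{\mathbf p}+\omega_{\mathbf q},\mathbf p+\mathbf q)\,a^\dagger(\mathbf p)a^\dagger(\mathbf q)\bigr]\mathrm d\mu(\mathbf p)\,\mathrm d\mu(\mathbf q).$$ Put $$c(h)=\sup_{\mathbf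 p,\mathbf k,\pm,\pm}\frac{\omega_{\mathbf p}^{D+1}}{m^2}\bigl|\tilde h(\pm\omega_{\mathbf p+\mathbf k}\pm\omega_{\mathbf k},\mathbf p)\bigr|$$ (independent signs) and $$K(f,h)=\max\Bigl[\|f_+\|_{L^2(\mu)},\ \|f_-\|_{L^2(\mu)},\ c(h),\ \max_{\pm}\Bigl(\iint\bigl|\tilde h(\pm(\omega_{\mathbf p}+\omega_{\mathbf q}),\mathbf p+\mathbf q)\bigr|^2\mathrm d\mu(\mathbf p)\,\mathrm d\mu(\mathbf q)\Bigr)^{1/2}\Bigr].$$ **Lemma.** For all $f\in\mathcal H$ and $h\in\mathcal S(\mathbb R^d)$ the operators $\Phi(f)$ and $:\!\Phi^2\!:\!(h)$ are well defined on $\mathcal F_0$ and map $\mathcal F_0$ into itself. For all $k,n\ge0$, $f_1,\dots,f_k\in\mathcal H$, $h_1,\dots,h_k\in\mathcal S(\mathbb R^d)$ and every $\psi\in\mathcal F_0$ containing at most $n$ particles, $$\Bigl\|\prod_{j=1}^k\bigl[\Phi(f_j)+:\!\Phi^2\!:\!(h_j)\bigr]\psi\Bigr\|\le\frac{20^k\,\Gamma\bigl(k+\frac{n+1}2\bigr)}{\Gamma\bigl(\frac{n+1}2\bigr)}\prod_{j=1}^kK(f_j,h_j)\,\|\psi\|,$$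 and $K(\alpha f,\beta h)\le\max(\alpha,\beta)K(f,h)$ for all $\alpha,\beta\ge0$. Moreover, for all $f\in\mathcal H$, $h\in\mathcal S(\mathbb R^d)$ and $\alpha,\beta\in\mathbb C$ such that $\alpha f$ is real and $\beta h$ is real-valued (in particular for real $\alpha,\beta$, real $f$ and real-valued $h$), the operator $\alpha\Phi(f)+\beta:\!\Phi^2\!:\!(h)$ with domain $\mathcal F_0$ is densely defined, symmetric and essentially self-adjoint. -/

import Mathlib

open MeasureTheory
open scoped ComplexConjugate

noncomputable section

namespace FreeField

/-- Momentum space `ℝ^D`. -/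
abbrev Momentum (D : ℕ) : Type := EuclideanSpace ℝ (Fin D)

/-- Minkowski space `ℝ^(D+1)`; the coordinate `x 0` is time. -/
abbrev Spacetime (D : ℕ) : Type := EuclideanSpace ℝ (Fin (D + 1))

/-- The energy `ω_p = √(m² + p²)`. -/
def energy (D : ℕ) (m : ℝ) (p : Momentum D) : ℝ := Real.sqrt (m ^ 2 + ‖p‖ ^ 2)

/-- The measure `dμ(p) = (2 ω_p)⁻¹ d^D p / (2π)^D` on the mass shell. -/
def shellMeasure (D : ℕ) (m : ℝ) : Measure (Momentum D) :=
  (volume : Measure (Momentum D)).withDensity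
    fun p => ENNReal.ofReal (1 / (2 * energy D m p * (2 * Real.pi) ^ D))

instance shellMeasure_sigmaFinite (D : ℕ) (m : ℝ) : SigmaFinite (shellMeasure D m) := by
  unfold shellMeasure
  exact SigmaFinite.withDensity_of_ne_top' (by simp)

/-- The Fourier transform `h̃(k⁰, k) = ∫ h(x) exp(-i (-k⁰ x⁰ + k · x)) dx`. -/
def fourierM {D : ℕ} (h : SchwartzMap (Spacetime D) ℂ) (k0 : ℝ) (k : Momentum D) : ℂ :=
  ∫ x : Spacetime D, h x *
    Complex.exp (-Complex.I * ((-(k0 * x 0) + ∑ i : Fin D, k i * x i.succ : ℝ) : ℂ))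

/-! ### Fock space -/

/-- The one-particle Hilbert space `L²(ℝ^D, dμ)`. The map `f ↦ f̃(ω_p, p)` identifies it with the
completion of the real Schwartz functions modulo those vanishing on the mass shell. -/
abbrev OneParticle (D : ℕ) (m : ℝ) : Type := Lp ℂ 2 (shellMeasure D m)

/-- The product measure `μ^{⊗n}`. -/
abbrev shellPi (D : ℕ) (m : ℝ) (n : ℕ) : Measure (Fin n → Momentum D) :=
  Measure.pi fun _ : Fin n => shellMeasure D m

theorem measurePreserving_perm (D : ℕ) (m : ℝ) (n : ℕ) (σ : Equiv.Perm (Fin n)) :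
    MeasurePreserving (fun P : Fin n → Momentum D => P ∘ σ) (shellPi D m n) (shellPi D m n) := by
  have h := measurePreserving_piCongrLeft (fun _ : Fin n => shellMeasure D m) σ.symm
  convert h using 1
  funext P i
  obtain ⟨j, rfl⟩ := σ.symm.surjective i
  rw [MeasurableEquiv.coe_piCongrLeft, Equiv.piCongrLeft_apply_apply]
  simp

/-- The symmetric `n`-particle space: square-integrable functions of `n` momenta that are invariant
under permutations of the arguments. -/
def NParticle (D : ℕ) (m : ℝ) (n : ℕ) : Submodule ℂ (Lp ℂ 2 (shellPi D m n)) where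
  carrier := {g | ∀ σ : Equiv.Perm (Fin n),
    Lp.compMeasurePreserving _ (measurePreserving_perm D m n σ) g = g}
  zero_mem' := fun σ => map_zero _
  add_mem' := fun {a b} ha hb σ => by rw [map_add, ha σ, hb σ]
  smul_mem' := fun c g hg σ => by
    have h := (Lp.compMeasurePreservingₗ ℂ _ (measurePreserving_perm D m n σ)
      (E := ℂ) (p := 2)).map_smul c g
    exact h.trans (congrArg (fun u => c • u) (hg σ))

theorem NParticle_isClosed (D : ℕ) (m : ℝ) (n : ℕ) :
    IsClosed (NParticle D m n : Set (Lp ℂ 2 (shellPi D m n))) := by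
  have : (NParticle D m n : Set (Lp ℂ 2 (shellPi D m n))) =
      ⋂ σ : Equiv.Perm (Fin n), {g | Lp.compMeasurePreserving _
        (measurePreserving_perm D m n σ) g = g} := by
    ext g
    simp only [Set.mem_iInter, Set.mem_setOf_eq]
    rfl
  rw [this]
  exact isClosed_iInter fun σ =>
    isClosed_eq (Lp.isometry_compMeasurePreserving _).continuous continuous_id

instance NParticle_complete (D : ℕ) (m : ℝ) (n : ℕ) : CompleteSpace (NParticle D m n) :=
  (NParticle_isClosed D m n).completeSpace_coe

/-- The symmetric Fock space: the Hilbert direct sum of the `n`-particle spaces. -/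
abbrev Fock (D : ℕ) (m : ℝ) : Type := lp (fun n : ℕ => NParticle D m n) 2

/-- The component `ψ^{(n)}` of a Fock space vector, as a function of `n` momenta. -/
def wave {D : ℕ} {m : ℝ} (ψ : Fock D m) (n : ℕ) : (Fin n → Momentum D) → ℂ :=
  ((ψ n : NParticle D m n) : Lp ℂ 2 (shellPi D m n))

/-- `ψ` contains at most `n` particles. -/
def AtMost {D : ℕ} {m : ℝ} (n : ℕ) (ψ : Fock D m) : Prop := ∀ l, n < l → ψ l = 0

/-- The finite-particle subspace `F₀`. -/
def FiniteParticle (D : ℕ) (m : ℝ) : Submodule ℂ (Fock D m) where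
  carrier := {ψ | ∃ n, AtMost n ψ}
  zero_mem' := ⟨0, fun l _ => rfl⟩
  add_mem' := by
    rintro a b ⟨n, hn⟩ ⟨k, hk⟩
    refine ⟨max n k, fun l hl => ?_⟩
    rw [lp.coeFn_add, Pi.add_apply, hn l (lt_of_le_of_lt (le_max_left _ _) hl),
      hk l (lt_of_le_of_lt (le_max_right _ _) hl), add_zero]
  smul_mem' := by
    rintro c a ⟨n, hn⟩
    refine ⟨n, fun l hl => ?_⟩
    rw [lp.coeFn_smul, Pi.smul_apply, hn l hl, smul_zero]

/-! ### The field -/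

/-- The complexified one-particle space of smearing functions. The element `f` is given by the
two functions `f.1 p = f̃(ω_p, p)` and `f.2 p = f̃(-ω_p, -p)`. -/
abbrev Smearing (D : ℕ) (m : ℝ) : Type := OneParticle D m × OneParticle D m

/-- The real elements: those with `f̃(-ω_p, -p) = conj f̃(ω_p, p)`. -/
def Smearing.IsReal {D : ℕ} {m : ℝ} (f : Smearing D m) : Prop :=
  f.2 =ᵐ[shellMeasure D m] fun p => conj (f.1 p)

/-- The `n`-particle component of `∫ u(p) a(p) dμ(p) ψ`. -/
def annTerm {D : ℕ} {m : ℝ} (u : Momentum D → ℂ) (ψ : Fock D m) (n : ℕ)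
    (P : Fin n → Momentum D) : ℂ :=
  (Real.sqrt (n + 1) : ℂ) *
    ∫ q, u q * wave ψ (n + 1) (Matrix.vecCons q P) ∂(shellMeasure D m)

/-- The `n`-particle component of `∫ u(p) a†(p) dμ(p) ψ`. -/
def creTerm {D : ℕ} {m : ℝ} (u : Momentum D → ℂ) (ψ : Fock D m) :
    (n : ℕ) → (Fin n → Momentum D) → ℂ
  | 0, _ => 0
  | n + 1, P => (Real.sqrt (n + 1) : ℂ)⁻¹ *
      ∑ i : Fin (n + 1), u (P i) * wave ψ n (fun l => P (i.succAbove l))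

/-- `T` is the field operator on `F₀`:
`T = 2^{-1/2} ∫ [f̃(-ω_p, -p) a(p) + f̃(ω_p, p) a†(p)] dμ(p)`. -/
def IsField {D : ℕ} {m : ℝ} (f : Smearing D m) (T : Module.End ℂ (FiniteParticle D m)) : Prop :=
  ∀ (ψ : FiniteParticle D m) (n : ℕ),
    wave (T ψ : Fock D m) n =ᵐ[shellPi D m n] fun P =>
      (Real.sqrt 2 : ℂ)⁻¹ * (annTerm f.2 (ψ : Fock D m) n P + creTerm f.1 (ψ : Fock D m) n P)

/-! ### The Wick square -/

/-- The `n`-particle component of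
`∬ h̃(-ω_p-ω_q, -p-q) a(p) a(q) dμ(p) dμ(q) ψ`. -/
def annAnnTerm {D : ℕ} {m : ℝ} (h : SchwartzMap (Spacetime D) ℂ) (ψ : Fock D m) (n : ℕ)
    (P : Fin n → Momentum D) : ℂ :=
  (Real.sqrt ((n + 1) * (n + 2)) : ℂ) *
    ∫ p, ∫ q, fourierM h (-energy D m p - energy D m q) (-p - q) *
      wave ψ (n + 2) (Matrix.vecCons p (Matrix.vecCons q P)) ∂(shellMeasure D m) ∂(shellMeasure D m)

/-- The `n`-particle component of
`∬ h̃(ω_p-ω_q, p-q) a†(p) a(q) dμ(p) dμ(q) ψ`. -/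
def creAnnTerm {D : ℕ} {m : ℝ} (h : SchwartzMap (Spacetime D) ℂ) (ψ : Fock D m) (n : ℕ)
    (P : Fin n → Momentum D) : ℂ :=
  ∑ i : Fin n, ∫ q, fourierM h (energy D m (P i) - energy D m q) (P i - q) *
    wave ψ n (Function.update P i q) ∂(shellMeasure D m)

/-- The `n`-particle component of
`∬ h̃(ω_p+ω_q, p+q) a†(p) a†(q) dμ(p) dμ(q) ψ`; the double sum runs over the ordered pairs of
distinct arguments. -/
def creCreTerm {D : ℕ} {m : ℝ} (h : SchwartzMap (Spacetime D) ℂ) (ψ : Fock D m) :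
    (n : ℕ) → (Fin n → Momentum D) → ℂ
  | 0, _ => 0
  | 1, _ => 0
  | n + 2, P => (Real.sqrt ((n + 1) * (n + 2)) : ℂ)⁻¹ *
      ∑ i : Fin (n + 2), ∑ j : Fin (n + 1),
        fourierM h (energy D m (P i) + energy D m (P (i.succAbove j)))
          (P i + P (i.succAbove j)) *
        wave ψ n (fun l => P (i.succAbove (j.succAbove l)))

/-- `T` is the Wick square on `F₀`, that is, the normally ordered square of the field smeared
with `h`:
`T = (1/2) ∬ [h̃(-ω_p-ω_q, -p-q) a(p) a(q) + 2 h̃(ω_p-ω_q, p-q) a†(p) a(q)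
  + h̃(ω_p+ω_q, p+q) a†(p) a†(q)] dμ(p) dμ(q)`. -/
def IsWickSquare {D : ℕ} {m : ℝ} (h : SchwartzMap (Spacetime D) ℂ)
    (T : Module.End ℂ (FiniteParticle D m)) : Prop :=
  ∀ (ψ : FiniteParticle D m) (n : ℕ),
    wave (T ψ : Fock D m) n =ᵐ[shellPi D m n] fun P =>
      (1 / 2 : ℂ) * (annAnnTerm h (ψ : Fock D m) n P + 2 * creAnnTerm h (ψ : Fock D m) n P
        + creCreTerm h (ψ : Fock D m) n P)

/-- An operator on `F₀` is determined by the wave functions of its values. -/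
theorem end_ext {D : ℕ} {m : ℝ} {T S : Module.End ℂ (FiniteParticle D m)}
    (h : ∀ (ψ : FiniteParticle D m) (n : ℕ),
      wave (T ψ : Fock D m) n =ᵐ[shellPi D m n] wave (S ψ : Fock D m) n) : T = S := by
  refine LinearMap.ext fun ψ => Subtype.ext (lp.ext (funext fun n => Subtype.ext ?_))
  exact Lp.ext (h ψ n)

theorem IsField.unique {D : ℕ} {m : ℝ} {f : Smearing D m}
    {T S : Module.End ℂ (FiniteParticle D m)} (hT : IsField f T) (hS : IsField f S) : T = S :=
  end_ext fun ψ n => (hT ψ n).trans (hS ψ n).symm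

theorem IsWickSquare.unique {D : ℕ} {m : ℝ} {h : SchwartzMap (Spacetime D) ℂ}
    {T S : Module.End ℂ (FiniteParticle D m)} (hT : IsWickSquare h T) (hS : IsWickSquare h S) :
    T = S :=
  end_ext fun ψ n => (hT ψ n).trans (hS ψ n).symm

/-- The field operator `Φ(f)` on `F₀`, the unique operator with `IsField f`. -/
def field {D : ℕ} {m : ℝ} (f : Smearing D m) : Module.End ℂ (FiniteParticle D m) :=
  Classical.epsilon (IsField f)

/-- The Wick square `:Φ²:(h)` on `F₀`, the unique operator with `IsWickSquare h`. -/
def wickSquare {D : ℕ} (m : ℝ) (h : SchwartzMap (Spacetime D) ℂ) :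
    Module.End ℂ (FiniteParticle D m) :=
  Classical.epsilon (IsWickSquare h)

/-! ### The constants -/

/-- `c(h) = sup (ω_p^{D+1} / m²) |h̃(± ω_{p+k} ± ω_k, p)|` over all `p`, `k` and both signs. -/
def cConst {D : ℕ} (m : ℝ) (h : SchwartzMap (Spacetime D) ℂ) : ℝ :=
  sSup {y : ℝ | ∃ (p k : Momentum D) (s t : ℤˣ),
    y = energy D m p ^ (D + 1) / m ^ 2 *
      ‖fourierM h (((s : ℤ) : ℝ) * energy D m (p + k) + ((t : ℤ) : ℝ) * energy D m k) p‖}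

/-- `(∬ |h̃(s (ω_p + ω_q), p + q)|² dμ(p) dμ(q))^{1/2}` for a sign `s`. -/
def pairNorm {D : ℕ} (m : ℝ) (h : SchwartzMap (Spacetime D) ℂ) (s : ℤˣ) : ℝ :=
  Real.sqrt (∫ p, ∫ q, ‖fourierM h (((s : ℤ) : ℝ) * (energy D m p + energy D m q)) (p + q)‖ ^ 2
    ∂(shellMeasure D m) ∂(shellMeasure D m))

/-- The constant `K(f, h)`; `‖f.1‖` and `‖f.2‖` are the `L²(dμ)` norms of `f̃(± ω_p, ± p)`,
which agree for real `f`. -/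
def KConst {D : ℕ} {m : ℝ} (f : Smearing D m) (h : SchwartzMap (Spacetime D) ℂ) : ℝ :=
  max (max ‖f.1‖ ‖f.2‖) (max (cConst m h) (max (pairNorm m h 1) (pairNorm m h (-1))))

/-! ### Essential self-adjointness -/

/-- An operator on `F₀` as an unbounded operator on Fock space with domain `F₀`. -/
def toPMap {D : ℕ} {m : ℝ} (T : Module.End ℂ (FiniteParticle D m)) :
    Fock D m →ₗ.[ℂ] Fock D m where
  domain := FiniteParticle D m
  toFun := (FiniteParticle D m).subtype ∘ₗ T

/-- A densely defined symmetric operator is essentially self-adjoint if its closure is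
self-adjoint. -/
def IsEssentiallySelfAdjoint {H : Type*} [NormedAddCommGroup H] [InnerProductSpace ℂ H]
    [CompleteSpace H] (A : H →ₗ.[ℂ] H) : Prop :=
  Dense (A.domain : Set H) ∧ A.IsFormalAdjoint A ∧ A.IsClosable ∧ IsSelfAdjoint A.closure

end FreeField

end

/-! Every operator involved adds at most two particles and is bounded by a constant times $N+1$ on
vectors with at most $N$ particles. The $j$-th factor of a product, counted from the right starting
at $0$, meets at most $n+2j$ particles and costs at most
$10K_j(n+2j+1)=20K_j\bigl(j+\frac{n+1}2\bigr)$. The functional equation of $\Gamma$ turns the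
product of these costs into the stated quotient (`norm_list_prod_le`).

The linear bound rests on kernel estimates. The amplitudes of $a$, $a^\dagger$, $aa$ and $a^\dagger
a^\dagger$ are square integrable, so Cauchy–Schwarz suffices. The kernel of $a^\dagger a$ is
dominated by $c(h)\,m^2\,\omega_{\mathbf p-\mathbf q}^{-D-1}$, and Schur's test gives it the norm
bound $c(h)$ (`isBoundedKernel_creAnnKernel`).

All five operators come from one construction, `Extraction.wickOp`: single out some arguments, apply
a kernel to them, and sum over all ways of placing the resulting arguments among the others.
Annihilators place none and creators single out none, expressed by the one-point space with its
Dirac measure. With the right normalization, the conjugate transposed kernel gives the adjoint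
(`Extraction.inner_normOp_left`), whence symmetry for real data.

Essential self-adjointness is an analytic vector argument. The bound for powers of one operator $T$
makes $\sum_k \frac{t^k}{k!}\|T^k\psi\|$ converge with one $t>0$ for all $\psi\in\mathcal F_0$,
because the successive quotients of $\Gamma(k+a)/k!$ tend to $1$. The series of $e^{\mathrm
isT}\psi$ is then isometric for $|s|=t$. Pairing it with a deficiency vector $\varphi$, with the
sign of $s$ suitably chosen, yields $e^t|\langle\varphi,\psi\rangle|\le\|\varphi\|\|\psi\|$, and
density forces $\varphi=0$ (`eq_zero_of_inner_eq_mul_inner`). Trivial deficiency spaces suffice by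
`isEssentiallySelfAdjoint_of_deficiency`. -/

noncomputable section

set_option linter.unusedSectionVars false

namespace FreeField

open scoped InnerProductSpace ENNReal NNReal FourierTransform

/-! ### Analytic vectors and essential self-adjointness -/

section AnalyticVectors

variable {H : Type*} [NormedAddCommGroup H] [InnerProductSpace ℂ H]

/-- An absolutely convergent double series of inner products, summed along antidiagonals. -/
theorem inner_tsum_tsum_eq_tsum_sum_antidiagonal [CompleteSpace H] {u v : ℕ → H}
    (hu : Summable fun k => ‖u k‖) (hv : Summable fun k => ‖v k‖) :
    ⟪∑' k, u k, ∑' k, v k⟫_ℂ =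
      ∑' N, ∑ p ∈ Finset.HasAntidiagonal.antidiagonal N, ⟪u p.1, v p.2⟫_ℂ := by
  have hs : Summable fun p : ℕ × ℕ => ⟪u p.1, v p.2⟫_ℂ := by
    refine Summable.of_norm_bounded (g := fun p : ℕ × ℕ => ‖u p.1‖ * ‖v p.2‖)
      (hu.mul_of_nonneg hv (fun _ => norm_nonneg _) (fun _ => norm_nonneg _)) ?_
    exact fun p => norm_inner_le_norm _ _
  have h1 : ⟪∑' k, u k, ∑' k, v k⟫_ℂ = ∑' p : ℕ × ℕ, ⟪u p.1, v p.2⟫_ℂ := by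
    rw [hs.tsum_prod]
    have hv' := hv.of_norm
    have hu' := hu.of_norm
    have e1 : ∀ x : H, ⟪x, ∑' k, v k⟫_ℂ = ∑' k, ⟪x, v k⟫_ℂ := fun x =>
      (innerSL ℂ x).map_tsum hv'
    have e2 : ∀ y : H, ⟪∑' k, u k, y⟫_ℂ = ∑' k, ⟪u k, y⟫_ℂ := fun y =>
      ((innerSL ℂ).flip y).map_tsum hu'
    rw [e2]
    simp_rw [e1]
  rw [h1, ← Finset.HasAntidiagonal.sigmaAntidiagonalEquivProd.tsum_eq]
  have hs' := (Finset.HasAntidiagonal.sigmaAntidiagonalEquivProd.summable_iff (f := fun p : ℕ × ℕ =>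
    ⟪u p.1, v p.2⟫_ℂ)).mpr hs
  refine (hs'.tsum_sigma' (fun n => (hasSum_fintype _).summable)).trans (tsum_congr fun n => ?_)
  rw [tsum_fintype]
  exact Finset.sum_coe_sort (Finset.HasAntidiagonal.antidiagonal n) fun p => ⟪u p.1, v p.2⟫_ℂ

variable {F : Submodule ℂ H} {T : Module.End ℂ F}

theorem inner_pow_apply_left (hT : ∀ x y : F, ⟪(T x : H), y⟫_ℂ = ⟪(x : H), T y⟫_ℂ) (k : ℕ)
    (x y : F) : ⟪((T ^ k) x : H), y⟫_ℂ = ⟪(x : H), ((T ^ k) y : F)⟫_ℂ := by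
  induction k generalizing x y with
  | zero => simp
  | succ k ih =>
    rw [pow_succ', Module.End.mul_apply, hT, ih, ← Module.End.mul_apply, ← pow_succ, ← pow_succ']

/-- The terms of the exponential series `exp(i s T) x`. -/
def expTerm (T : Module.End ℂ F) (s : ℝ) (x : F) (k : ℕ) : H :=
  ((Complex.I * s) ^ k / (k.factorial : ℂ)) • ((T ^ k) x : H)

theorem norm_expTerm (T : Module.End ℂ F) (s : ℝ) (x : F) (k : ℕ) :
    ‖expTerm T s x k‖ = |s| ^ k / k.factorial * ‖((T ^ k) x : H)‖ := by
  simp [expTerm, norm_smul]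

/-- The binomial theorem. With `a = -b` every sum beyond `N = 0` vanishes, which is why the
exponential series is isometric. -/
theorem sum_antidiagonal_pow_div_factorial (a b : ℂ) (N : ℕ) :
    ∑ p ∈ Finset.HasAntidiagonal.antidiagonal N, a ^ p.1 / (p.1.factorial : ℂ) * (b ^ p.2 / (p.2.factorial : ℂ))
      = (a + b) ^ N / (N.factorial : ℂ) := by
  rw [(Commute.all a b).add_pow', Finset.sum_div]
  refine Finset.sum_congr rfl fun p hp => ?_
  have hp' : p.1 + p.2 = N := Finset.HasAntidiagonal.mem_antidiagonal.mp hp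
  subst hp'
  have h := Nat.add_choose_mul_factorial_mul_factorial p.1 p.2
  have h' : (((p.1 + p.2).choose p.1 : ℕ) : ℂ) * p.1.factorial * p.2.factorial
      = (p.1 + p.2).factorial := by
    rw [Nat.choose_symm_add]
    exact_mod_cast h
  have n1 : (p.1.factorial : ℂ) ≠ 0 := by exact_mod_cast p.1.factorial_ne_zero
  have n2 : (p.2.factorial : ℂ) ≠ 0 := by exact_mod_cast p.2.factorial_ne_zero
  have n3 : ((p.1 + p.2).factorial : ℂ) ≠ 0 := by exact_mod_cast (p.1 + p.2).factorial_ne_zero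
  rw [nsmul_eq_mul]
  field_simp
  rw [← h']
  ring

/-- The exponential series of a symmetric operator is isometric where it converges absolutely. -/
theorem norm_tsum_expTerm [CompleteSpace H]
    (hT : ∀ x y : F, ⟪(T x : H), y⟫_ℂ = ⟪(x : H), T y⟫_ℂ) (s : ℝ) (x : F)
    (hs : Summable fun k => ‖expTerm T s x k‖) : ‖∑' k, expTerm T s x k‖ = ‖x‖ := by
  have key : ⟪∑' k, expTerm T s x k, ∑' k, expTerm T s x k⟫_ℂ = ⟪(x : H), (x : H)⟫_ℂ := by
    rw [inner_tsum_tsum_eq_tsum_sum_antidiagonal hs hs]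
    have hterm : ∀ N, ∑ p ∈ Finset.HasAntidiagonal.antidiagonal N, ⟪expTerm T s x p.1, expTerm T s x p.2⟫_ℂ
        = (0 : ℂ) ^ N / (N.factorial : ℂ) * ⟪(x : H), ((T ^ N) x : F)⟫_ℂ := by
      intro N
      -- Conjugation turns the left coefficient `i s` into `-i s`, and symmetry moves all powers of
      -- `T` to the right. The antidiagonal `N` thus carries `(-i s + i s) ^ N`, and only `N = 0`
      -- survives.
      have h0 : (0 : ℂ) = -(Complex.I * s) + Complex.I * s := by ring
      rw [h0, ← sum_antidiagonal_pow_div_factorial, Finset.sum_mul]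
      refine Finset.sum_congr rfl fun p hp => ?_
      have hp' : p.1 + p.2 = N := Finset.HasAntidiagonal.mem_antidiagonal.mp hp
      subst hp'
      rw [expTerm, expTerm, inner_smul_left, inner_smul_right, inner_pow_apply_left hT,
        ← Module.End.mul_apply, ← pow_add]
      simp only [map_div₀, map_pow, map_mul, Complex.conj_I, Complex.conj_ofReal, map_natCast,
        neg_mul]
      ring
    rw [tsum_congr hterm, tsum_eq_single 0 (fun N hN => by simp [hN])]
    simp
  rw [inner_self_eq_norm_sq_to_K, inner_self_eq_norm_sq_to_K] at key
  have key' : ‖∑' k, expTerm T s x k‖ ^ 2 = ‖(x : H)‖ ^ 2 := by exact_mod_cast key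
  exact (sq_eq_sq₀ (norm_nonneg _) (norm_nonneg _)).mp key'

/-- A symmetric operator with a dense set of analytic vectors of uniform radius has trivial
deficiency spaces. -/
theorem eq_zero_of_inner_eq_mul_inner [CompleteSpace H] (hF : Dense (F : Set H))
    (hT : ∀ x y : F, ⟪(T x : H), y⟫_ℂ = ⟪(x : H), T y⟫_ℂ) {t : ℝ} (ht : 0 < t)
    (hs : ∀ x : F, Summable fun k => t ^ k / k.factorial * ‖((T ^ k) x : H)‖)
    {φ : H} {ε : ℝ} (hε : |ε| = 1) (hφ : ∀ x : F, ⟪φ, (T x : H)⟫_ℂ = (ε * Complex.I) * ⟪φ, (x : H)⟫_ℂ) :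
    φ = 0 := by
  have hpow : ∀ (k : ℕ) (x : F), ⟪φ, ((T ^ k) x : H)⟫_ℂ = (ε * Complex.I) ^ k * ⟪φ, (x : H)⟫_ℂ := by
    intro k x
    induction k with
    | zero => simp
    | succ k ih => rw [pow_succ', Module.End.mul_apply, hφ, ih, pow_succ']; ring
  have hεε : ε * ε = 1 := by rw [← abs_mul_abs_self, hε, one_mul]
  -- The choice `s = -ε t` makes `(i s) (ε i) = ε² t = t`, so that pairing `φ` with the series
  -- produces `exp t`.
  have hsum : ∀ x : F, Summable fun k => ‖expTerm T (-(ε * t)) x k‖ := fun x => by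
    refine (hs x).congr fun k => ?_
    rw [norm_expTerm, abs_neg, abs_mul, hε, one_mul, abs_of_pos ht]
  have hle : ∀ x : F, Real.exp t * ‖⟪φ, (x : H)⟫_ℂ‖ ≤ ‖φ‖ * ‖(x : H)‖ := by
    intro x
    have e1 : ⟪φ, ∑' k, expTerm T (-(ε * t)) x k⟫_ℂ = Complex.exp t * ⟪φ, (x : H)⟫_ℂ := by
      have := (innerSL ℂ φ).map_tsum (hsum x).of_norm
      simp only [innerSL_apply_apply] at this
      rw [this, Complex.exp_eq_exp_ℂ, NormedSpace.exp_eq_tsum_div, ← tsum_mul_right]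
      refine tsum_congr fun k => ?_
      rw [expTerm, inner_smul_right, hpow, ← mul_assoc]
      congr 1
      rw [div_mul_eq_mul_div, ← mul_pow]
      congr 2
      have : Complex.I * ((-(ε * t) : ℝ) : ℂ) * (ε * Complex.I)
          = -(Complex.I * Complex.I) * ((ε * ε : ℝ) : ℂ) * t := by push_cast; ring
      rw [this, hεε]; simp
    have e2 := norm_inner_le_norm (𝕜 := ℂ) φ (∑' k, expTerm T (-(ε * t)) x k)
    rw [e1, norm_tsum_expTerm hT _ _ (hsum x), norm_mul, Complex.norm_exp_ofReal] at e2
    exact e2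
  -- Density carries the inequality to `y = φ`, where `exp t > 1` is a contradiction unless `φ = 0`.
  -- This needs one `t` for all of `F`.
  have hle' : ∀ y : H, Real.exp t * ‖⟪φ, y⟫_ℂ‖ ≤ ‖φ‖ * ‖y‖ := by
    intro y
    refine hF.induction (P := fun y => Real.exp t * ‖⟪φ, y⟫_ℂ‖ ≤ ‖φ‖ * ‖y‖)
      (fun x hx => hle ⟨x, hx⟩) (isClosed_le (by fun_prop) (by fun_prop)) y
  have h := hle' φ
  rw [inner_self_eq_norm_sq_to_K] at h
  by_contra hne
  have hpos : 0 < ‖φ‖ := norm_pos_iff.mpr hne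
  have h1 : 1 < Real.exp t := Real.one_lt_exp_iff.mpr ht
  have h2 : Real.exp t * (‖φ‖ * ‖φ‖) ≤ ‖φ‖ * ‖φ‖ := by
    simpa [sq] using h
  nlinarith [mul_pos hpos hpos]

end AnalyticVectors

/-! ### The basic criterion -/

section BasicCriterion

variable {H : Type*} [NormedAddCommGroup H] [InnerProductSpace ℂ H] {A : H →ₗ.[ℂ] H}

/-- Symmetry is an equality of continuous functions of two graph elements, hence survives closure.
-/
theorem inner_eq_of_mem_closure_graph_of_symmetric (hA : A.IsFormalAdjoint A) {p q : H × H}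
    (hp : p ∈ A.graph.topologicalClosure) (hq : q ∈ A.graph.topologicalClosure) :
    ⟪p.2, q.1⟫_ℂ = ⟪p.1, q.2⟫_ℂ := by
  have h : (p, q) ∈ closure ((A.graph : Set (H × H)) ×ˢ (A.graph : Set (H × H))) := by
    rw [closure_prod_eq]; exact ⟨hp, hq⟩
  refine closure_minimal (t := {z : (H × H) × (H × H) | ⟪z.1.2, z.2.1⟫_ℂ = ⟪z.1.1, z.2.2⟫_ℂ})
    ?_ (isClosed_eq (by fun_prop) (by fun_prop)) h
  rintro ⟨a, b⟩ ⟨ha, hb⟩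
  obtain ⟨x, hx1, hx2⟩ := (LinearPMap.mem_graph_iff A).mp ha
  obtain ⟨y, hy1, hy2⟩ := (LinearPMap.mem_graph_iff A).mp hb
  change ⟪a.2, b.1⟫_ℂ = ⟪a.1, b.2⟫_ℂ
  rw [← hx1, ← hx2, ← hy1, ← hy2]
  exact hA x y

/-- The cross term is `2 Re (i ⟪y, x⟫)`, and symmetry makes the inner product real. With `y = A x`
this bounds both `x` and `A x` by `(A + i) x`. -/
theorem norm_sq_add_I_smul_of_symmetric {x y : H} (h : ⟪y, x⟫_ℂ = ⟪x, y⟫_ℂ) :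
    ‖y + Complex.I • x‖ ^ 2 = ‖y‖ ^ 2 + ‖x‖ ^ 2 := by
  have him : (⟪y, x⟫_ℂ).im = 0 := by
    have h2 := inner_conj_symm (𝕜 := ℂ) y x
    rw [← h] at h2
    exact Complex.conj_eq_iff_im.mp h2
  rw [@norm_add_sq ℂ, inner_smul_right, norm_smul, Complex.norm_I, one_mul]
  simp [him]

/-- A densely defined symmetric operator with trivial deficiency spaces is essentially
self-adjoint. -/
theorem isEssentiallySelfAdjoint_of_deficiency [CompleteSpace H] (hd : Dense (A.domain : Set H))
    (hA : A.IsFormalAdjoint A)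
    (hdef : ∀ (φ : H) (ε : ℝ), |ε| = 1 →
      (∀ x : A.domain, ⟪φ, A x⟫_ℂ = (ε * Complex.I) * ⟪φ, (x : H)⟫_ℂ) → φ = 0) :
    IsEssentiallySelfAdjoint A := by
  have hle : A ≤ A.adjoint := hA.le_adjoint hd
  have hadjcl : A.adjoint.IsClosed := LinearPMap.adjoint_isClosed hd
  have hclos : A.IsClosable := hadjcl.isClosable.leIsClosable hle
  have hgraph : A.graph.topologicalClosure = A.closure.graph :=
    hclos.graph_closure_eq_closure_graph
  have hdcl : Dense (A.closure.domain : Set H) := hd.mono A.le_closure.1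
  have hsymm : A.closure.IsFormalAdjoint A.closure := by
    intro x y
    have := inner_eq_of_mem_closure_graph_of_symmetric hA (p := (x, A.closure x))
      (q := (y, A.closure y)) (hgraph ▸ A.closure.mem_graph x) (hgraph ▸ A.closure.mem_graph y)
    exact this
  refine ⟨hd, hA, hclos, ?_⟩
  rw [LinearPMap.isSelfAdjoint_def]
  refine le_antisymm ?_ (hsymm.le_adjoint hdcl)
  refine LinearPMap.le_of_le_graph ?_
  rintro ⟨x, y⟩ hxy
  have hxyA : ∀ z : A.domain, ⟪y, (z : H)⟫_ℂ = ⟪x, A z⟫_ℂ := by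
    intro z
    obtain ⟨w, hw1, hw2⟩ := (LinearPMap.mem_graph_iff _).mp hxy
    have hz := A.le_closure.1 z.2
    have h2 := A.le_closure.2 (x := z) (y := ⟨z, hz⟩) rfl
    have h3 := LinearPMap.adjoint_isFormalAdjoint hdcl w ⟨z, hz⟩
    simp only at hw1 hw2
    rw [← h2, hw1, hw2] at h3
    exact h3
  -- `L` is `A + i` read on the graph. The closed graph is complete and `L` is bounded below on it,
  -- so the range is closed.
  let L : H × H →L[ℂ] H := ContinuousLinearMap.snd ℂ H H + Complex.I • ContinuousLinearMap.fst ℂ H H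
  have hLa : ∀ p : H × H, L p = p.2 + Complex.I • p.1 := fun p => rfl
  let G : Submodule ℂ (H × H) := A.graph.topologicalClosure
  have : CompleteSpace G := A.graph.isClosed_topologicalClosure.completeSpace_coe
  have hanti : AntilipschitzWith 1 (L.comp G.subtypeL) := by
    refine ContinuousLinearMap.antilipschitz_of_bound _ fun p => ?_
    have hn := norm_sq_add_I_smul_of_symmetric
      (inner_eq_of_mem_closure_graph_of_symmetric hA p.2 p.2)
    change ‖(p : H × H)‖ ≤ (1 : NNReal) * ‖L p‖
    rw [NNReal.coe_one, one_mul, hLa, Prod.norm_def]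
    refine max_le ?_ ?_
    · exact (sq_le_sq₀ (norm_nonneg _) (norm_nonneg _)).mp (by nlinarith [sq_nonneg ‖(p : H × H).2‖])
    · exact (sq_le_sq₀ (norm_nonneg _) (norm_nonneg _)).mp (by nlinarith [sq_nonneg ‖(p : H × H).1‖])
  have hclosed : IsClosed (Set.range (L.comp G.subtypeL)) :=
    hanti.isClosed_range (L.comp G.subtypeL).uniformContinuous
  let R : Submodule ℂ H := (L.comp G.subtypeL).toLinearMap.range
  have hR : R = ⊤ := by
    have : CompleteSpace R := by
      have : IsClosed (R : Set H) := hclosed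
      exact this.completeSpace_coe
    rw [← Submodule.orthogonal_eq_bot_iff, Submodule.eq_bot_iff]
    intro φ hφ
    -- Orthogonality to all `(A + i) z` says `⟪φ, A z⟫ = -i ⟪φ, z⟫`.
    refine hdef φ (-1) (by simp) fun z => ?_
    have hmem : A z + Complex.I • (z : H) ∈ R :=
      ⟨⟨((z : H), A z), A.graph.le_topologicalClosure (A.mem_graph z)⟩, rfl⟩
    have h0 := (Submodule.mem_orthogonal' R φ).mp hφ _ hmem
    rw [inner_add_right, inner_smul_right] at h0
    push_cast
    linear_combination h0
  have hmem : y + Complex.I • x ∈ R := hR ▸ Submodule.mem_top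
  -- Surjectivity yields a point of the closed graph with the same image under `L` as the given
  -- point `(x, y)` of the adjoint graph. The difference `x - x'` satisfies the deficiency equation
  -- with `ε = 1`, so the two points coincide.
  obtain ⟨⟨⟨x', y'⟩, hG⟩, heq⟩ := hmem
  have heq' : y' + Complex.I • x' = y + Complex.I • x := heq
  have hx : x - x' = 0 := by
    refine hdef _ 1 (by simp) fun z => ?_
    have h1 := hxyA z
    have h2 := inner_eq_of_mem_closure_graph_of_symmetric hA hG
      (A.graph.le_topologicalClosure (A.mem_graph z))
    have h3 : y - y' = -(Complex.I • (x - x')) := by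
      have h5 : y = y' + Complex.I • x' - Complex.I • x := by rw [heq', add_sub_cancel_right]
      rw [h5, smul_sub]
      abel
    have h4 : ⟪y - y', (z : H)⟫_ℂ = ⟪x - x', A z⟫_ℂ := by
      rw [inner_sub_left, inner_sub_left, h1]; simp only at h2; rw [h2]
    rw [← h4, h3, inner_neg_left, inner_smul_left]
    simp only [Complex.conj_I, Complex.ofReal_one]
    ring
  have hxx : x' = x := (sub_eq_zero.mp hx).symm
  subst hxx
  have hyy : y' = y := add_right_cancel heq'
  subst hyy
  rw [← hgraph]
  exact hG

end BasicCriterion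

/-! ### Integral kernels acting on one factor of a product -/

section Kernels

variable {X X' Y Y' : Type*} [MeasurableSpace X] [MeasurableSpace X'] [MeasurableSpace Y]
  [MeasurableSpace Y']

theorem sq_lintegral_mul_le {μ : Measure X} {f g : X → ℝ≥0∞} (hf : AEMeasurable f μ)
    (hg : AEMeasurable g μ) :
    (∫⁻ x, f x * g x ∂μ) ^ 2 ≤ (∫⁻ x, f x ^ 2 ∂μ) * ∫⁻ x, g x ^ 2 ∂μ := by
  have h := ENNReal.lintegral_mul_le_Lp_mul_Lq μ Real.HolderConjugate.two_two hf hg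
  have h2 := pow_le_pow_left₀ (zero_le) h 2
  refine h2.trans_eq ?_
  rw [mul_pow]
  simp only [← ENNReal.rpow_natCast, ← ENNReal.rpow_mul]
  norm_num

theorem eLpNorm_two_sq {E : Type*} [NormedAddCommGroup E] {μ : Measure X} (f : X → E) :
    eLpNorm f 2 μ ^ 2 = ∫⁻ x, ‖f x‖ₑ ^ 2 ∂μ := by
  have h := eLpNorm_nnreal_pow_eq_lintegral (f := f) (μ := μ) (p := 2) two_ne_zero
  rw [show ((2 : ℝ≥0) : ℝ) = ((2 : ℕ) : ℝ) by norm_num] at h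
  simp only [ENNReal.rpow_natCast] at h
  exact_mod_cast h

theorem ae_ae_swap {μ : Measure X} {ν : Measure Y} [SFinite μ] [SFinite ν] {p : X × Y → Prop}
    (h : ∀ᵐ z ∂μ.prod ν, p z) : ∀ᵐ y ∂ν, ∀ᵐ x ∂μ, p (x, y) :=
  Measure.ae_ae_of_ae_prod (p := fun z : Y × X => p (z.2, z.1))
    ((Measure.measurePreserving_swap (μ := ν) (ν := μ)).quasiMeasurePreserving.ae h)

/-- A measurable kernel whose absolute value is bounded by `C` as an operator on `L²`. -/
structure IsBoundedKernel (μ' : Measure X') (μ : Measure X) (k : X' → X → ℂ) (C : ℝ≥0) : Prop where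
  stronglyMeasurable : StronglyMeasurable (Function.uncurry k)
  bound : ∀ v : X → ℝ≥0∞, Measurable v →
    ∫⁻ x', (∫⁻ x, ‖k x' x‖ₑ * v x ∂μ) ^ 2 ∂μ' ≤ (C : ℝ≥0∞) ^ 2 * ∫⁻ x, v x ^ 2 ∂μ

/-- Cauchy–Schwarz in `x` for each fixed `x'`. -/
theorem isBoundedKernel_of_hilbertSchmidt {μ' : Measure X'} {μ : Measure X} [SFinite μ]
    {k : X' → X → ℂ} {C : ℝ≥0} (hk : StronglyMeasurable (Function.uncurry k))
    (hC : ∫⁻ x', ∫⁻ x, ‖k x' x‖ₑ ^ 2 ∂μ ∂μ' ≤ (C : ℝ≥0∞) ^ 2) : IsBoundedKernel μ' μ k C := by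
  refine ⟨hk, fun v hv => ?_⟩
  have hm : Measurable fun x' => ∫⁻ x, ‖k x' x‖ₑ ^ 2 ∂μ :=
    (hk.enorm.pow_const 2).lintegral_prod_right'
  calc ∫⁻ x', (∫⁻ x, ‖k x' x‖ₑ * v x ∂μ) ^ 2 ∂μ'
      ≤ ∫⁻ x', (∫⁻ x, ‖k x' x‖ₑ ^ 2 ∂μ) * ∫⁻ x, v x ^ 2 ∂μ ∂μ' := by
        refine lintegral_mono fun x' => sq_lintegral_mul_le ?_ hv.aemeasurable
        exact (hk.comp_measurable measurable_prodMk_left).enorm.aemeasurable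
    _ = (∫⁻ x', ∫⁻ x, ‖k x' x‖ₑ ^ 2 ∂μ ∂μ') * ∫⁻ x, v x ^ 2 ∂μ := lintegral_mul_const _ hm
    _ ≤ _ := by gcongr

/-- Schur's test: write `|k| v` as `|k|^{1/2} · |k|^{1/2} v` and apply Cauchy–Schwarz. One factor is
a row integral; after Tonelli the other is controlled by column integrals. -/
theorem isBoundedKernel_of_schur {μ' : Measure X'} {μ : Measure X} [SFinite μ] [SFinite μ']
    {k : X' → X → ℂ} {C : ℝ≥0} (hk : StronglyMeasurable (Function.uncurry k))
    (hr : ∀ x', ∫⁻ x, ‖k x' x‖ₑ ∂μ ≤ C) (hc : ∀ x, ∫⁻ x', ‖k x' x‖ₑ ∂μ' ≤ C) :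
    IsBoundedKernel μ' μ k C := by
  refine ⟨hk, fun v hv => ?_⟩
  have hkm : ∀ x', Measurable fun x => ‖k x' x‖ₑ := fun x' =>
    (hk.comp_measurable measurable_prodMk_left).enorm
  calc ∫⁻ x', (∫⁻ x, ‖k x' x‖ₑ * v x ∂μ) ^ 2 ∂μ'
      ≤ ∫⁻ x', C * ∫⁻ x, ‖k x' x‖ₑ * v x ^ 2 ∂μ ∂μ' := by
        refine lintegral_mono fun x' => ?_
        have h := sq_lintegral_mul_le (μ := μ) (f := fun x => ‖k x' x‖ₑ ^ (1 / 2 : ℝ))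
          (g := fun x => ‖k x' x‖ₑ ^ (1 / 2 : ℝ) * v x) ((hkm x').pow_const _).aemeasurable
          (((hkm x').pow_const _).mul hv).aemeasurable
        have e : ∀ a : ℝ≥0∞, (a ^ (1 / 2 : ℝ)) ^ 2 = a := fun a => by
          rw [← ENNReal.rpow_natCast, ← ENNReal.rpow_mul]; norm_num
        simp only [← mul_assoc, ← sq, mul_pow, e] at h
        exact h.trans (by gcongr; exact hr x')
    _ = C * ∫⁻ x, ∫⁻ x', ‖k x' x‖ₑ * v x ^ 2 ∂μ' ∂μ := by
        rw [lintegral_const_mul' _ _ ENNReal.coe_ne_top, lintegral_lintegral_swap]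
        exact (hk.enorm.mul ((hv.comp measurable_snd).pow_const 2)).aemeasurable
    _ ≤ C * ∫⁻ x, C * v x ^ 2 ∂μ := by
        gcongr with x
        have hkx : Measurable fun x' => ‖k x' x‖ₑ :=
          (hk.comp_measurable measurable_prodMk_right).enorm
        rw [lintegral_mul_const _ hkx]
        gcongr
        exact hc x
    _ = _ := by
        rw [lintegral_const_mul' _ _ ENNReal.coe_ne_top, ← mul_assoc, sq]

variable {μ : Measure X} {μ' : Measure X'} {ν : Measure Y} {ν' : Measure Y'}
  [SigmaFinite μ] [SigmaFinite μ'] [SigmaFinite ν] [SigmaFinite ν'] {k : X' → X → ℂ} {C C' : ℝ≥0}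

/-- The kernel `k` applied to the first variable of `g`. -/
def kernelInt (μ : Measure X) (k : X' → X → ℂ) (g : X × Y → ℂ) (z : X' × Y) : ℂ :=
  ∫ x, k z.1 x * g (x, z.2) ∂μ

/-- A null set of the product has null sections at almost every second variable, so the kernel acts
on classes of functions. -/
theorem kernelInt_congr {g g' : X × Y → ℂ} (h : g =ᵐ[μ.prod ν] g') :
    kernelInt μ k g =ᵐ[μ'.prod ν] kernelInt μ k g' := by
  have h2 := (Measure.quasiMeasurePreserving_snd (μ := μ') (ν := ν)).ae (ae_ae_swap h)
  filter_upwards [h2] with z hz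
  refine integral_congr_ae ?_
  filter_upwards [hz] with x hx
  rw [hx]

/-! ### The operator of a kernel on a product space and its adjoint -/

namespace IsBoundedKernel

/-- The second variable is a spectator: the bound applies at each fixed `y`, and `y` is integrated
last. The constant therefore does not depend on how many arguments are left untouched. -/
theorem lintegral_sq_le (hk : IsBoundedKernel μ' μ k C) {g : X × Y → ℂ}
    (hg : StronglyMeasurable g) :
    ∫⁻ z, (∫⁻ x, ‖k z.1 x‖ₑ * ‖g (x, z.2)‖ₑ ∂μ) ^ 2 ∂(μ'.prod ν)
      ≤ (C : ℝ≥0∞) ^ 2 * ∫⁻ z, ‖g z‖ₑ ^ 2 ∂(μ.prod ν) := by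
  have hm : Measurable fun w : (X' × Y) × X => ‖k w.1.1 w.2‖ₑ * ‖g (w.2, w.1.2)‖ₑ :=
    (hk.stronglyMeasurable.comp_measurable
      ((measurable_fst.comp measurable_fst).prodMk measurable_snd)).enorm.mul
    (hg.comp_measurable (measurable_snd.prodMk (measurable_snd.comp measurable_fst))).enorm
  rw [lintegral_prod_symm' _ (hm.lintegral_prod_right'.pow_const 2),
    lintegral_prod_symm' _ (hg.enorm.pow_const 2),
    ← lintegral_const_mul' _ _ (by simp)]
  refine lintegral_mono fun y => ?_
  exact hk.bound _ (hg.comp_measurable measurable_prodMk_right).enorm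

theorem lintegral_sq_lt_top (hk : IsBoundedKernel μ' μ k C) (g : Lp ℂ 2 (μ.prod ν)) :
    ∫⁻ z, (∫⁻ x, ‖k z.1 x‖ₑ * ‖g (x, z.2)‖ₑ ∂μ) ^ 2 ∂(μ'.prod ν) < ∞ := by
  refine (hk.lintegral_sq_le (Lp.stronglyMeasurable g)).trans_lt ?_
  rw [← eLpNorm_two_sq]
  exact ENNReal.mul_lt_top (by simp) (ENNReal.pow_lt_top (Lp.eLpNorm_lt_top g))

theorem stronglyMeasurable_integrand (hk : IsBoundedKernel μ' μ k C) (g : Lp ℂ 2 (μ.prod ν)) :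
    StronglyMeasurable fun w : (X' × Y) × X => k w.1.1 w.2 * g (w.2, w.1.2) :=
  (hk.stronglyMeasurable.comp_measurable
      ((measurable_fst.comp measurable_fst).prodMk measurable_snd)).mul
    ((Lp.stronglyMeasurable g).comp_measurable
      (measurable_snd.prodMk (measurable_snd.comp measurable_fst)))

theorem ae_integrable (hk : IsBoundedKernel μ' μ k C) (g : Lp ℂ 2 (μ.prod ν)) :
    ∀ᵐ z ∂(μ'.prod ν), Integrable (fun x => k z.1 x * g (x, z.2)) μ := by
  have hm := hk.stronglyMeasurable_integrand g
  have h := ae_lt_top' ((hm.enorm.lintegral_prod_right'.pow_const 2).aemeasurable (μ := μ'.prod ν))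
    (by simpa only [enorm_mul] using (hk.lintegral_sq_lt_top g).ne)
  filter_upwards [h] with z hz
  refine ⟨(hm.comp_measurable measurable_prodMk_left).aestronglyMeasurable, ?_⟩
  exact (ENNReal.pow_lt_top_iff.mp hz).resolve_right two_ne_zero

theorem eLpNorm_kernelInt_le (hk : IsBoundedKernel μ' μ k C) (g : Lp ℂ 2 (μ.prod ν)) :
    eLpNorm (kernelInt μ k g) 2 (μ'.prod ν) ≤ C * eLpNorm g 2 (μ.prod ν) := by
  rw [← ENNReal.pow_le_pow_left_iff two_ne_zero, mul_pow, eLpNorm_two_sq, eLpNorm_two_sq]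
  refine le_trans ?_ (hk.lintegral_sq_le (Lp.stronglyMeasurable g))
  gcongr with z
  refine (enorm_integral_le_lintegral_enorm _).trans_eq ?_
  simp only [enorm_mul]

theorem memLp_kernelInt (hk : IsBoundedKernel μ' μ k C) (g : Lp ℂ 2 (μ.prod ν)) :
    MemLp (kernelInt μ k g) 2 (μ'.prod ν) :=
  ⟨(hk.stronglyMeasurable_integrand g).integral_prod_right'.aestronglyMeasurable,
    (hk.eLpNorm_kernelInt_le g).trans_lt
      (ENNReal.mul_lt_top ENNReal.coe_lt_top (Lp.eLpNorm_lt_top g))⟩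

variable (ν) in
/-- The bounded operator given by a bounded kernel acting on the first variable. -/
def op (hk : IsBoundedKernel μ' μ k C) : Lp ℂ 2 (μ.prod ν) →L[ℂ] Lp ℂ 2 (μ'.prod ν) :=
  LinearMap.mkContinuous
    { toFun := fun g => (hk.memLp_kernelInt g).toLp
      map_add' := fun g g' => by
        refine Lp.ext ?_
        filter_upwards [MemLp.coeFn_toLp (hk.memLp_kernelInt (g + g')),
          MemLp.coeFn_toLp (hk.memLp_kernelInt g), MemLp.coeFn_toLp (hk.memLp_kernelInt g'),
          Lp.coeFn_add (hk.memLp_kernelInt g).toLp (hk.memLp_kernelInt g').toLp,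
          kernelInt_congr (μ' := μ') (k := k) (Lp.coeFn_add g g'),
          hk.ae_integrable g, hk.ae_integrable g'] with z h1 h2 h3 h4 h5 h6 h7
        rw [h1, h4, Pi.add_apply, h2, h3, h5]
        simp only [kernelInt, Pi.add_apply, mul_add]
        exact integral_add h6 h7
      map_smul' := fun c g => by
        refine Lp.ext ?_
        filter_upwards [MemLp.coeFn_toLp (hk.memLp_kernelInt (c • g)),
          MemLp.coeFn_toLp (hk.memLp_kernelInt g),
          Lp.coeFn_smul c (hk.memLp_kernelInt g).toLp,
          kernelInt_congr (μ' := μ') (k := k) (Lp.coeFn_smul c g)] with z h1 h2 h4 h5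
        rw [h1, RingHom.id_apply, h4, Pi.smul_apply, h2, h5]
        simp only [kernelInt, Pi.smul_apply, smul_eq_mul, mul_left_comm _ c]
        exact integral_const_mul c _ }
    C (fun g => by
      change ‖(hk.memLp_kernelInt g).toLp‖ ≤ C * ‖g‖
      rw [Lp.norm_toLp, Lp.norm_def, ← ENNReal.coe_toReal C, ← ENNReal.toReal_mul]
      exact ENNReal.toReal_mono (ENNReal.mul_lt_top ENNReal.coe_lt_top (Lp.eLpNorm_lt_top g)).ne
        (hk.eLpNorm_kernelInt_le g))

theorem coeFn_op (hk : IsBoundedKernel μ' μ k C) (g : Lp ℂ 2 (μ.prod ν)) :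
    hk.op ν g =ᵐ[μ'.prod ν] kernelInt μ k g :=
  MemLp.coeFn_toLp (hk.memLp_kernelInt g)

theorem norm_op_apply_le (hk : IsBoundedKernel μ' μ k C) (g : Lp ℂ 2 (μ.prod ν)) :
    ‖hk.op ν g‖ ≤ C * ‖g‖ :=
  (ContinuousLinearMap.le_opNorm _ _).trans
    (mul_le_mul_of_nonneg_right (LinearMap.mkContinuous_norm_le _ C.2 _) (norm_nonneg _))

/-- This licenses Fubini in the adjoint formula. Since the bound concerns `|k|`, the inequality `a b
≤ a² + b²` reduces the claim to two finite square integrals. -/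
theorem integrable_sesq (hk : IsBoundedKernel μ' μ k C) (g : Lp ℂ 2 (μ.prod ν))
    (w : Lp ℂ 2 (μ'.prod ν)) :
    Integrable (fun p : (X' × Y) × X => conj (k p.1.1 p.2 * g (p.2, p.1.2)) * w p.1)
      ((μ'.prod ν).prod μ) := by
  have hm := hk.stronglyMeasurable_integrand g
  have hw : StronglyMeasurable fun p : (X' × Y) × X => w p.1 :=
    (Lp.stronglyMeasurable w).comp_measurable measurable_fst
  have hmw : StronglyMeasurable fun p : (X' × Y) × X =>
      conj (k p.1.1 p.2 * g (p.2, p.1.2)) * w p.1 :=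
    (Complex.continuous_conj.comp_stronglyMeasurable hm).mul hw
  refine ⟨hmw.aestronglyMeasurable, ?_⟩
  rw [hasFiniteIntegral_iff_enorm, lintegral_prod _ hmw.enorm.aemeasurable]
  have hb : ∀ a b : ℝ≥0∞, a * b ≤ a ^ 2 + b ^ 2 := by
    intro a b
    rcases le_total a b with h | h
    · calc a * b ≤ b ^ 2 := by rw [sq]; gcongr
        _ ≤ _ := le_add_self
    · calc a * b ≤ a ^ 2 := by rw [sq]; gcongr
        _ ≤ _ := le_self_add
  calc ∫⁻ z, ∫⁻ x, ‖conj (k z.1 x * g (x, z.2)) * w z‖ₑ ∂μ ∂(μ'.prod ν)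
      = ∫⁻ z, (∫⁻ x, ‖k z.1 x‖ₑ * ‖g (x, z.2)‖ₑ ∂μ) * ‖w z‖ₑ ∂(μ'.prod ν) := by
        refine lintegral_congr fun z => ?_
        have hz := (hm.comp_measurable (measurable_prodMk_left (x := z))).enorm
        rw [← lintegral_mul_const _ (by simpa only [enorm_mul, Function.comp_def] using hz)]
        refine lintegral_congr fun x => ?_
        rw [enorm_mul, RCLike.enorm_conj, enorm_mul]
    _ ≤ ∫⁻ z, ((∫⁻ x, ‖k z.1 x‖ₑ * ‖g (x, z.2)‖ₑ ∂μ) ^ 2 + ‖w z‖ₑ ^ 2) ∂(μ'.prod ν) :=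
        lintegral_mono fun z => hb _ _
    _ = (∫⁻ z, (∫⁻ x, ‖k z.1 x‖ₑ * ‖g (x, z.2)‖ₑ ∂μ) ^ 2 ∂(μ'.prod ν)) +
          ∫⁻ z, ‖w z‖ₑ ^ 2 ∂(μ'.prod ν) :=
        lintegral_add_right _ ((Lp.stronglyMeasurable w).enorm.pow_const 2)
    _ < ∞ := by
        refine ENNReal.add_lt_top.mpr ⟨hk.lintegral_sq_lt_top g, ?_⟩
        rw [← eLpNorm_two_sq]
        exact ENNReal.pow_lt_top (Lp.eLpNorm_lt_top w)

/-- The adjoint of the operator of a kernel is the operator of the conjugate transposed kernel. -/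
theorem inner_op_left (hk : IsBoundedKernel μ' μ k C) {k' : X → X' → ℂ}
    (hk' : IsBoundedKernel μ μ' k' C') (hkk : ∀ x x', k' x x' = conj (k x' x))
    (g : Lp ℂ 2 (μ.prod ν)) (w : Lp ℂ 2 (μ'.prod ν)) :
    ⟪hk.op ν g, w⟫_ℂ = ⟪g, hk'.op ν w⟫_ℂ := by
  -- Exchanging `x` and `x'` identifies the two pairings as iterated integrals of one integrable
  -- function.
  let e : (X × Y) × X' → (X' × Y) × X := fun p => ((p.2, p.1.2), p.1.1)
  have he : MeasurePreserving e ((μ.prod ν).prod μ') ((μ'.prod ν).prod μ) := by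
    have h1 := measurePreserving_prodAssoc μ ν μ'
    have h2 := Measure.measurePreserving_swap (μ := μ) (ν := ν.prod μ')
    have h3 := (Measure.measurePreserving_swap (μ := ν) (ν := μ')).prod (MeasurePreserving.id μ)
    exact h3.comp (h2.comp h1)
  have heq : MeasurableEmbedding e := by
    let E : (X × Y) × X' ≃ᵐ (X' × Y) × X :=
      { toFun := e
        invFun := fun p => ((p.2, p.1.2), p.1.1)
        left_inv := fun _ => rfl
        right_inv := fun _ => rfl
        measurable_toFun := he.measurable
        measurable_invFun := by
          change Measurable fun p : (X' × Y) × X => ((p.2, p.1.2), p.1.1)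
          fun_prop }
    exact E.measurableEmbedding
  have hI := hk.integrable_sesq g w
  rw [L2.inner_def, L2.inner_def]
  calc ∫ z, ⟪hk.op ν g z, w z⟫_ℂ ∂(μ'.prod ν)
      = ∫ z, ∫ x, conj (k z.1 x * g (x, z.2)) * w z ∂μ ∂(μ'.prod ν) := by
        refine integral_congr_ae ?_
        filter_upwards [hk.coeFn_op g] with z hz
        rw [hz, RCLike.inner_apply', kernelInt, ← integral_conj, integral_mul_const]
    _ = ∫ p, conj (k p.1.1 p.2 * g (p.2, p.1.2)) * w p.1 ∂((μ'.prod ν).prod μ) :=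
        (integral_prod _ hI).symm
    _ = ∫ p, conj (k p.2 p.1.1 * g p.1) * w (p.2, p.1.2) ∂((μ.prod ν).prod μ') :=
        (he.integral_comp heq _).symm
    _ = ∫ z, ∫ x', conj (k x' z.1 * g z) * w (x', z.2) ∂μ' ∂(μ.prod ν) :=
        integral_prod _ (he.integrable_comp_of_integrable hI)
    _ = ∫ z, ⟪g z, hk'.op ν w z⟫_ℂ ∂(μ.prod ν) := by
        refine integral_congr_ae ?_
        filter_upwards [hk'.coeFn_op w] with z hz
        rw [hz, RCLike.inner_apply', kernelInt, ← integral_const_mul]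
        refine integral_congr_ae (Filter.Eventually.of_forall fun x' => ?_)
        simp only [hkk, map_mul]
        ring

/-- The kernel and `τ` act on different variables. This keeps the symmetry in the spectator
arguments. -/
theorem compMeasurePreserving_op (hk : IsBoundedKernel μ' μ k C) {τ : Y → Y'}
    (hτ : MeasurePreserving τ ν ν') (g : Lp ℂ 2 (μ.prod ν')) :
    Lp.compMeasurePreserving _ ((MeasurePreserving.id μ').prod hτ) (hk.op ν' g) =
      hk.op ν (Lp.compMeasurePreserving _ ((MeasurePreserving.id μ).prod hτ) g) := by
  refine Lp.ext ?_
  have h1 := ((MeasurePreserving.id μ').prod hτ).quasiMeasurePreserving.ae (hk.coeFn_op g)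
  filter_upwards [Lp.coeFn_compMeasurePreserving (hk.op ν' g) ((MeasurePreserving.id μ').prod hτ),
    hk.coeFn_op (Lp.compMeasurePreserving _ ((MeasurePreserving.id μ).prod hτ) g), h1,
    kernelInt_congr (μ' := μ') (k := k)
      (Lp.coeFn_compMeasurePreserving g ((MeasurePreserving.id μ).prod hτ))] with z h2 h3 h4 h5
  rw [h2, h3, h5, Function.comp_apply, h4]
  rfl

end IsBoundedKernel

end Kernels

/-! ### Pullbacks -/

section Pullback

variable {X Y Z : Type*} [MeasurableSpace X] [MeasurableSpace Y] [MeasurableSpace Z]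
  {μ : Measure X} {ν : Measure Y} {ρ : Measure Z}

/-- Pullback of square-integrable functions along a measure preserving map. -/
abbrev pull {f : X → Y} (hf : MeasurePreserving f μ ν) : Lp ℂ 2 ν →ₗᵢ[ℂ] Lp ℂ 2 μ :=
  Lp.compMeasurePreservingₗᵢ ℂ f hf

theorem coeFn_pull {f : X → Y} (hf : MeasurePreserving f μ ν) (g : Lp ℂ 2 ν) :
    pull hf g =ᵐ[μ] g ∘ f :=
  Lp.coeFn_compMeasurePreserving g hf

theorem pull_congr {f f' : X → Y} (hf : MeasurePreserving f μ ν) (hf' : MeasurePreserving f' μ ν)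
    (h : ∀ x, f x = f' x) (g : Lp ℂ 2 ν) : pull hf g = pull hf' g := by
  obtain rfl : f = f' := funext h
  rfl

theorem pull_pull {f : Y → Z} {f' : X → Y} (hf : MeasurePreserving f ν ρ)
    (hf' : MeasurePreserving f' μ ν) (g : Lp ℂ 2 ρ) :
    pull hf' (pull hf g) = pull (hf.comp hf') g :=
  (Lp.compMeasurePreserving_comp_apply g hf hf').symm

end Pullback

/-! ### Extracting particles -/

section Extraction

variable {D : ℕ} {m : ℝ}

theorem mem_NParticle_iff {n : ℕ} {g : Lp ℂ 2 (shellPi D m n)} :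
    g ∈ NParticle D m n ↔ ∀ σ : Equiv.Perm (Fin n), pull (measurePreserving_perm D m n σ) g = g :=
  Iff.rfl

/-- The ways to single out some of the `N` arguments of a wave function: `proj e` splits the
arguments into the singled out ones and the `n` remaining ones, `insert` puts the singled out
arguments in front of the others. -/
structure Extraction (D : ℕ) (m : ℝ) (N n : ℕ) {X : Type} [MeasurableSpace X] (ρ : Measure X)
    (E : Type) where
  proj : E → (Fin N → Momentum D) → X × (Fin n → Momentum D)
  insert : X × (Fin n → Momentum D) → Fin N → Momentum D
  measurePreserving_proj : ∀ e,
    MeasurePreserving (proj e) (shellPi D m N) (ρ.prod (shellPi D m n))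
  measurePreserving_insert : MeasurePreserving insert (ρ.prod (shellPi D m n)) (shellPi D m N)
  proj_perm : ∀ σ : Equiv.Perm (Fin N), ∃ s : Equiv.Perm E, ∀ e, ∃ τ : Equiv.Perm (Fin n),
    ∀ P, proj e (P ∘ σ) = Prod.map id (fun Q => Q ∘ τ) (proj (s e) P)
  insert_proj : ∀ e, ∃ σ : Equiv.Perm (Fin N), ∀ P, insert (proj e P) = P ∘ σ
  insert_perm : ∀ τ : Equiv.Perm (Fin n), ∃ σ : Equiv.Perm (Fin N),
    ∀ z, insert (Prod.map id (fun Q => Q ∘ τ) z) = insert z ∘ σ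

/-- `σ` maps the complement of `i` bijectively onto that of `σ i`; numbering both complements by
`Fin n` gives `τ`. -/
theorem exists_perm_succAbove {n : ℕ} (σ : Equiv.Perm (Fin (n + 1))) (i : Fin (n + 1)) :
    ∃ τ : Equiv.Perm (Fin n), ∀ l, σ (i.succAbove l) = (σ i).succAbove (τ l) := by
  have h : ∀ l, ∃ l', (σ i).succAbove l' = σ (i.succAbove l) := fun l =>
    Fin.exists_succAbove_eq fun h => Fin.succAbove_ne i l (σ.injective h)
  choose f hf using h
  have hinj : Function.Injective f := fun a b hab =>
    Fin.succAbove_right_injective (σ.injective (by rw [← hf a, ← hf b, hab]))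
  exact ⟨Equiv.ofBijective f (Finite.injective_iff_bijective.mp hinj), fun l => (hf l).symm⟩

theorem exists_perm_cons {n : ℕ} (i : Fin (n + 1)) (f : Fin n → Fin (n + 1))
    (hf : Function.Injective f) (hi : ∀ l, f l ≠ i) :
    ∃ σ : Equiv.Perm (Fin (n + 1)), σ 0 = i ∧ ∀ l : Fin n, σ l.succ = f l := by
  have hinj : Function.Injective (Fin.cons i f : Fin (n + 1) → Fin (n + 1)) := by
    rw [Fin.cons_injective_iff]
    exact ⟨fun ⟨l, hl⟩ => hi l hl, hf⟩
  exact ⟨Equiv.ofBijective _ (Finite.injective_iff_bijective.mp hinj), rfl, fun l => rfl⟩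

/-- No argument is singled out. -/
def extractNone (D : ℕ) (m : ℝ) (n : ℕ) : Extraction D m n n (Measure.dirac ()) Unit where
  proj _ P := ((), P)
  insert z := z.2
  measurePreserving_proj _ :=
    ⟨measurable_prodMk_left, (Measure.dirac_prod ()).symm⟩
  measurePreserving_insert := measurePreserving_snd
  proj_perm σ := ⟨1, fun _ => ⟨σ, fun _ => rfl⟩⟩
  insert_proj _ := ⟨1, fun _ => rfl⟩
  insert_perm τ := ⟨τ, fun _ => rfl⟩

/-- One argument is singled out. -/
def extractOne (D : ℕ) (m : ℝ) (n : ℕ) :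
    Extraction D m (n + 1) n (shellMeasure D m) (Fin (n + 1)) where
  proj i P := (P i, fun l => P (i.succAbove l))
  insert z := Matrix.vecCons z.1 z.2
  measurePreserving_proj i := measurePreserving_piFinSuccAbove (fun _ => shellMeasure D m) i
  measurePreserving_insert := by
    have h := (measurePreserving_piFinSuccAbove (fun _ => shellMeasure D m) (0 : Fin (n + 1))).symm
    convert h using 1
    funext z
    change Matrix.vecCons z.1 z.2 = Fin.insertNth 0 z.1 z.2
    rw [Fin.insertNth_zero]
    rfl
  proj_perm σ := by
    refine ⟨σ, fun i => ?_⟩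
    obtain ⟨τ, hτ⟩ := exists_perm_succAbove σ i
    refine ⟨τ, fun P => Prod.ext rfl (funext fun l => ?_)⟩
    exact congrArg P (hτ l)
  insert_proj i := by
    obtain ⟨σ, h0, hs⟩ := exists_perm_cons i i.succAbove Fin.succAbove_right_injective
      (fun l => Fin.succAbove_ne i l)
    refine ⟨σ, fun P => funext fun j => ?_⟩
    refine Fin.cases ?_ (fun l => ?_) j
    · exact congrArg P h0.symm
    · exact congrArg P (hs l).symm
  insert_perm τ := by
    obtain ⟨σ, h0, hs⟩ := exists_perm_cons 0 (fun l => (τ l).succ)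
      ((Fin.succ_injective n).comp τ.injective) (fun l => Fin.succ_ne_zero _)
    refine ⟨σ, fun z => funext fun j => ?_⟩
    refine Fin.cases ?_ (fun l => ?_) j
    · rw [Function.comp_apply, h0]; rfl
    · rw [Function.comp_apply, hs]; rfl

/-- Singling out arguments in two steps. -/
def Extraction.comp {N n n' : ℕ} {X X' : Type} [MeasurableSpace X] [MeasurableSpace X']
    {ρ : Measure X} {ρ' : Measure X'} [SigmaFinite ρ] [SigmaFinite ρ'] {E E' : Type}
    (A : Extraction D m N n ρ E) (B : Extraction D m n n' ρ' E') :
    Extraction D m N n' (ρ.prod ρ') (E × E') where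
  proj e P := (((A.proj e.1 P).1, (B.proj e.2 (A.proj e.1 P).2).1),
    (B.proj e.2 (A.proj e.1 P).2).2)
  insert z := A.insert (z.1.1, B.insert (z.1.2, z.2))
  measurePreserving_proj e := by
    have h1 := (measurePreserving_prodAssoc ρ ρ' (shellPi D m n')).symm
    have h2 := (MeasurePreserving.id ρ).prod (B.measurePreserving_proj e.2)
    exact h1.comp (h2.comp (A.measurePreserving_proj e.1))
  measurePreserving_insert := by
    have h1 := measurePreserving_prodAssoc ρ ρ' (shellPi D m n')
    have h2 := (MeasurePreserving.id ρ).prod B.measurePreserving_insert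
    exact A.measurePreserving_insert.comp (h2.comp h1)
  proj_perm σ := by
    obtain ⟨s, hs⟩ := A.proj_perm σ
    choose τ hτ using hs
    choose s' hs' using fun e => B.proj_perm (τ e)
    -- The permutation of the second choice depends on the first choice, hence a sheared product.
    refine ⟨Equiv.prodShear s s', fun e => ?_⟩
    obtain ⟨τ', hτ'⟩ := hs' e.1 e.2
    refine ⟨τ', fun P => ?_⟩
    simp only [hτ, Prod.map_fst, Prod.map_snd, hτ', id, Equiv.prodShear_apply]
    rfl
  insert_proj e := by
    obtain ⟨σ, hσ⟩ := A.insert_proj e.1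
    obtain ⟨τ, hτ⟩ := B.insert_proj e.2
    obtain ⟨σ', hσ'⟩ := A.insert_perm τ
    refine ⟨σ * σ', fun P => ?_⟩
    have h := hσ' (A.proj e.1 P)
    rw [hσ] at h
    simp only [Prod.mk.eta, hτ]
    exact h
  insert_perm τ := by
    obtain ⟨σ, hσ⟩ := B.insert_perm τ
    obtain ⟨σ', hσ'⟩ := A.insert_perm σ
    refine ⟨σ', fun z => ?_⟩
    rw [← hσ']
    have h := hσ (z.1.2, z.2)
    exact congrArg A.insert (Prod.ext rfl h)

/-- Two arguments are singled out. -/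
def extractTwo (D : ℕ) (m : ℝ) (n : ℕ) :
    Extraction D m (n + 2) n ((shellMeasure D m).prod (shellMeasure D m))
      (Fin (n + 2) × Fin (n + 1)) :=
  (extractOne D m (n + 1)).comp (extractOne D m n)

/-! ### Symmetrization and operators between particle sectors -/

namespace Extraction

variable {N N' n : ℕ} {X X' : Type} [MeasurableSpace X] [MeasurableSpace X']
  {ρ : Measure X} {ρ' : Measure X'} [SigmaFinite ρ] [SigmaFinite ρ'] {E E' : Type}
  [Fintype E] [Fintype E'] (A : Extraction D m N n ρ E) (B : Extraction D m N' n ρ' E')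

/-- Symmetry in the arguments that are not singled out. -/
def IsSymm (W : Lp ℂ 2 (ρ.prod (shellPi D m n))) : Prop :=
  ∀ τ : Equiv.Perm (Fin n),
    pull ((MeasurePreserving.id ρ).prod (measurePreserving_perm D m n τ)) W = W

theorem isSymm_pull_insert {g : Lp ℂ 2 (shellPi D m N)} (hg : g ∈ NParticle D m N) :
    IsSymm (pull A.measurePreserving_insert g) := by
  intro τ
  obtain ⟨σ, hσ⟩ := A.insert_perm τ
  conv_rhs => rw [← mem_NParticle_iff.mp hg σ]
  rw [pull_pull, pull_pull]
  exact pull_congr _ _ hσ g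

/-- The sum over all ways to single out arguments. -/
def symm (W : Lp ℂ 2 (ρ.prod (shellPi D m n))) : Lp ℂ 2 (shellPi D m N) :=
  ∑ e, pull (A.measurePreserving_proj e) W

/-- A permutation of the arguments permutes the summands, up to a permutation of the remaining
arguments, which `W` absorbs. -/
theorem symm_mem_NParticle {W : Lp ℂ 2 (ρ.prod (shellPi D m n))} (hW : IsSymm W) :
    A.symm W ∈ NParticle D m N := by
  rw [mem_NParticle_iff]
  intro σ
  obtain ⟨s, hs⟩ := A.proj_perm σ
  have h : ∀ e, pull (measurePreserving_perm D m N σ) (pull (A.measurePreserving_proj e) W)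
      = pull (A.measurePreserving_proj (s e)) W := by
    intro e
    obtain ⟨τ, hτ⟩ := hs e
    conv_rhs => rw [← hW τ]
    rw [pull_pull, pull_pull]
    exact pull_congr _ _ hτ W
  rw [symm, map_sum]
  simp_rw [h]
  exact Equiv.sum_comp s fun e => pull (A.measurePreserving_proj e) W

theorem norm_symm_le (W : Lp ℂ 2 (ρ.prod (shellPi D m n))) :
    ‖A.symm W‖ ≤ Fintype.card E * ‖W‖ := by
  refine (norm_sum_le _ _).trans ?_
  simp

/-- All summands contribute equally: splitting and reinserting only permutes the arguments of the
symmetric `g`, and pullbacks are isometric. -/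
theorem inner_symm_left (W : Lp ℂ 2 (ρ.prod (shellPi D m n))) {g : Lp ℂ 2 (shellPi D m N)}
    (hg : g ∈ NParticle D m N) :
    ⟪A.symm W, g⟫_ℂ = Fintype.card E * ⟪W, pull A.measurePreserving_insert g⟫_ℂ := by
  have h : ∀ e, ⟪pull (A.measurePreserving_proj e) W, g⟫_ℂ
      = ⟪W, pull A.measurePreserving_insert g⟫_ℂ := by
    intro e
    obtain ⟨σ, hσ⟩ := A.insert_proj e
    have h1 : pull (A.measurePreserving_proj e) (pull A.measurePreserving_insert g) = g := by
      conv_rhs => rw [← mem_NParticle_iff.mp hg σ]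
      rw [pull_pull]
      exact pull_congr _ _ hσ g
    conv_lhs => rw [← h1]
    exact LinearIsometry.inner_map_map _ _ _
  rw [symm, sum_inner]
  simp [h]

theorem isSymm_op {k : X' → X → ℂ} {C : ℝ≥0} (hk : IsBoundedKernel ρ' ρ k C)
    {W : Lp ℂ 2 (ρ.prod (shellPi D m n))} (hW : IsSymm W) : IsSymm (hk.op (shellPi D m n) W) := by
  intro τ
  have h := hk.compMeasurePreserving_op (measurePreserving_perm D m n τ) W
  refine h.trans (congrArg _ (hW τ))

/-- The operator from `N`-particle to `N'`-particle vectors that annihilates the particles singled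
out by `A` and creates those singled out by `B`, with amplitude `k`. -/
def wickOp {k : X' → X → ℂ} {C : ℝ≥0} (hk : IsBoundedKernel ρ' ρ k C) :
    NParticle D m N →ₗ[ℂ] NParticle D m N' where
  toFun g := ⟨B.symm (hk.op _ (pull A.measurePreserving_insert (g : Lp ℂ 2 (shellPi D m N)))),
    B.symm_mem_NParticle (isSymm_op hk (A.isSymm_pull_insert g.2))⟩
  map_add' g g' := Subtype.ext (by simp [symm, Finset.sum_add_distrib])
  map_smul' c g := Subtype.ext (by simp [symm, Finset.smul_sum])

theorem coe_wickOp {k : X' → X → ℂ} {C : ℝ≥0} (hk : IsBoundedKernel ρ' ρ k C)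
    (g : NParticle D m N) : (A.wickOp B hk g : Lp ℂ 2 (shellPi D m N')) =
      B.symm (hk.op _ (pull A.measurePreserving_insert (g : Lp ℂ 2 (shellPi D m N)))) := rfl

theorem norm_wickOp_le {k : X' → X → ℂ} {C : ℝ≥0} (hk : IsBoundedKernel ρ' ρ k C)
    (g : NParticle D m N) : ‖A.wickOp B hk g‖ ≤ Fintype.card E' * C * ‖g‖ := by
  have h1 := hk.norm_op_apply_le (pull A.measurePreserving_insert (g : Lp ℂ 2 (shellPi D m N)))
  rw [LinearIsometry.norm_map] at h1
  calc ‖A.wickOp B hk g‖ ≤ _ := B.norm_symm_le _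
    _ ≤ Fintype.card E' * (C * ‖g‖) := by gcongr; exact h1
    _ = _ := by ring

/-- Each symmetrization contributes its number of choices. The square roots in `normOp` later remove
this imbalance. -/
theorem inner_wickOp_left {k : X' → X → ℂ} {k' : X → X' → ℂ} {C C' : ℝ≥0}
    (hk : IsBoundedKernel ρ' ρ k C) (hk' : IsBoundedKernel ρ ρ' k' C')
    (hkk : ∀ x x', k' x x' = conj (k x' x)) (g : NParticle D m N) (w : NParticle D m N') :
    Fintype.card E * ⟪A.wickOp B hk g, w⟫_ℂ = Fintype.card E' * ⟪g, B.wickOp A hk' w⟫_ℂ := by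
  rw [Submodule.coe_inner, Submodule.coe_inner, coe_wickOp, coe_wickOp, inner_symm_left B _ w.2,
    ← inner_conj_symm (g : Lp ℂ 2 (shellPi D m N)), inner_symm_left A _ g.2, map_mul,
    inner_conj_symm, hk.inner_op_left hk' hkk, Complex.conj_natCast]
  ring

theorem coeFn_wickOp {k : X' → X → ℂ} {C : ℝ≥0} (hk : IsBoundedKernel ρ' ρ k C)
    (g : NParticle D m N) : (A.wickOp B hk g : Lp ℂ 2 (shellPi D m N')) =ᵐ[shellPi D m N'] fun P =>
      ∑ e, ∫ x, k (B.proj e P).1 x *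
        (g : Lp ℂ 2 (shellPi D m N)) (A.insert (x, (B.proj e P).2)) ∂ρ := by
  rw [coe_wickOp, symm]
  set W := pull A.measurePreserving_insert (g : Lp ℂ 2 (shellPi D m N)) with hW
  have h1 : ∀ e, (pull (B.measurePreserving_proj e) (hk.op _ W) : (Fin N' → Momentum D) → ℂ)
      =ᵐ[shellPi D m N'] fun P => ∫ x, k (B.proj e P).1 x *
        (g : Lp ℂ 2 (shellPi D m N)) (A.insert (x, (B.proj e P).2)) ∂ρ := by
    intro e
    have hq := (B.measurePreserving_proj e).quasiMeasurePreserving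
    filter_upwards [coeFn_pull (B.measurePreserving_proj e) (hk.op _ W),
      hq.ae (hk.coeFn_op W), hq.ae (kernelInt_congr (μ' := ρ') (k := k)
        (coeFn_pull A.measurePreserving_insert (g : Lp ℂ 2 (shellPi D m N))))] with P h2 h3 h4
    rw [h2, Function.comp_apply, h3, hW, h4]
    rfl
  have h2 := Lp.coeFn_finsetSum (p := 2) (μ := shellPi D m N') Finset.univ
    fun e => pull (B.measurePreserving_proj e) (hk.op _ W)
  filter_upwards [h2, ae_all_iff.mpr h1] with P h3 h4
  rw [h3, Finset.sum_apply]
  exact Finset.sum_congr rfl fun e _ => h4 e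

end Extraction

end Extraction

/-! ### Operators on Fock space that shift the particle number -/

section Shift

variable {D : ℕ} {m : ℝ} {r s : ℕ}

/-- `T` acts on the `(n + s)`-particle component as `O n` with values in the `(n + r)`-particle
space, and annihilates vectors with fewer than `s` particles. -/
structure IsShift (O : ∀ n, NParticle D m (n + s) →ₗ[ℂ] NParticle D m (n + r))
    (T : Module.End ℂ (FiniteParticle D m)) : Prop where
  apply_add : ∀ (ψ : FiniteParticle D m) n, (T ψ : Fock D m) (n + r) = O n ((ψ : Fock D m) (n + s))
  apply_of_lt : ∀ (ψ : FiniteParticle D m) j, j < r → (T ψ : Fock D m) j = 0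

/-- The components of the image of a shift operator. -/
def shiftFun (O : ∀ n, NParticle D m (n + s) →ₗ[ℂ] NParticle D m (n + r)) :
    (∀ n, NParticle D m n) →ₗ[ℂ] ∀ n, NParticle D m n :=
  LinearMap.pi fun j => if h : r ≤ j then
    (Nat.sub_add_cancel h ▸ (O (j - r) ∘ₗ LinearMap.proj (j - r + s)) :
      (∀ n, NParticle D m n) →ₗ[ℂ] NParticle D m j) else 0

theorem shiftFun_apply_add (O : ∀ n, NParticle D m (n + s) →ₗ[ℂ] NParticle D m (n + r))
    (x : ∀ n, NParticle D m n) (n : ℕ) : shiftFun O x (n + r) = O n (x (n + s)) := by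
  -- With a free variable `n'` in place of `n + r - r` the cast can be eliminated by substitution.
  have key : ∀ (n' : ℕ) (e : n' + r = n + r),
      (e ▸ (O n' ∘ₗ LinearMap.proj (n' + s)) :
        (∀ n, NParticle D m n) →ₗ[ℂ] NParticle D m (n + r)) x = O n (x (n + s)) := by
    intro n' e
    obtain rfl : n' = n := by omega
    rfl
  rw [shiftFun, LinearMap.pi_apply, dif_pos (Nat.le_add_left r n)]
  exact key _ _

theorem shiftFun_apply_of_lt (O : ∀ n, NParticle D m (n + s) →ₗ[ℂ] NParticle D m (n + r))
    (x : ∀ n, NParticle D m n) {j : ℕ} (hj : j < r) : shiftFun O x j = 0 := by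
  rw [shiftFun, LinearMap.pi_apply, dif_neg (by omega)]
  rfl

theorem memℓp_of_eventually_zero {x : ∀ n, NParticle D m n} {N : ℕ} (h : ∀ l, N < l → x l = 0) :
    Memℓp x 2 := by
  refine memℓp_gen (summable_of_ne_finset_zero (s := Finset.range (N + 1)) fun l hl => ?_)
  rw [h l (by simpa [Nat.lt_succ_iff] using hl)]
  simp

theorem shiftFun_eq_zero (O : ∀ n, NParticle D m (n + s) →ₗ[ℂ] NParticle D m (n + r))
    {x : ∀ n, NParticle D m n} {N : ℕ} (h : ∀ l, N < l → x l = 0) {l : ℕ} (hl : N + r < l) :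
    shiftFun O x l = 0 := by
  obtain ⟨n, rfl⟩ : ∃ n, l = n + r := ⟨l - r, by omega⟩
  rw [shiftFun_apply_add, h _ (by omega), map_zero]

theorem exists_isShift (O : ∀ n, NParticle D m (n + s) →ₗ[ℂ] NParticle D m (n + r)) :
    ∃ T : Module.End ℂ (FiniteParticle D m), IsShift O T := by
  have hmem : ∀ ψ : FiniteParticle D m, Memℓp (shiftFun O ((ψ : Fock D m) : ∀ n, _)) 2 := by
    rintro ⟨ψ, N, hN⟩
    exact memℓp_of_eventually_zero (N := N + r) fun l hl => shiftFun_eq_zero O hN hl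
  refine ⟨{ toFun := fun ψ => ⟨⟨shiftFun O ((ψ : Fock D m) : ∀ n, _), hmem ψ⟩, ?_⟩
            map_add' := fun ψ φ => ?_, map_smul' := fun c ψ => ?_ }, ⟨fun ψ n => ?_, fun ψ j hj => ?_⟩⟩
  · obtain ⟨ψ, N, hN⟩ := ψ
    exact ⟨N + r, fun l hl => shiftFun_eq_zero O hN hl⟩
  · exact Subtype.ext (Subtype.ext (map_add (shiftFun O) _ _))
  · exact Subtype.ext (Subtype.ext (map_smul (shiftFun O) c _))
  · exact shiftFun_apply_add O _ n
  · exact shiftFun_apply_of_lt O _ hj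

variable {O : ∀ n, NParticle D m (n + s) →ₗ[ℂ] NParticle D m (n + r)}
  {T : Module.End ℂ (FiniteParticle D m)}

theorem IsShift.atMost (hT : IsShift O T) {ψ : FiniteParticle D m} {N : ℕ}
    (hψ : AtMost N (ψ : Fock D m)) : AtMost (N + r) (T ψ : Fock D m) := by
  intro l hl
  obtain ⟨n, rfl⟩ : ∃ n, l = n + r := ⟨l - r, by omega⟩
  rw [hT.apply_add, hψ _ (by omega), map_zero]

theorem hasSum_norm_sq (ψ : Fock D m) : HasSum (fun n => ‖ψ n‖ ^ 2) (‖ψ‖ ^ 2) := by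
  have h := lp.hasSum_norm (p := 2) (by norm_num) ψ
  rw [show (2 : ℝ≥0∞).toReal = ((2 : ℕ) : ℝ) by norm_num] at h
  simpa only [Real.rpow_natCast] using h

/-- The first `r` terms of `a` vanish, and the first `s` terms of `b` only enlarge the right-hand
side. -/
theorem le_mul_of_hasSum_shift {a b : ℕ → ℝ} {x y c : ℝ} (ha : HasSum a x) (hb : HasSum b y)
    (hc : 0 ≤ c) (hb0 : ∀ n, 0 ≤ b n) (ha0 : ∀ j, j < r → a j = 0)
    (h : ∀ n, a (n + r) ≤ c * b (n + s)) : x ≤ c * y := by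
  rw [← ha.tsum_eq, ← hb.tsum_eq, ← ha.summable.sum_add_tsum_nat_add r,
    Finset.sum_eq_zero fun j hj => ha0 j (Finset.mem_range.mp hj), zero_add]
  calc ∑' n, a (n + r) ≤ ∑' n, c * b (n + s) :=
        Summable.tsum_le_tsum h ((summable_nat_add_iff r).mpr ha.summable)
          (((summable_nat_add_iff s).mpr hb.summable).mul_left _)
    _ = c * ∑' n, b (n + s) := tsum_mul_left
    _ ≤ c * ∑' n, b n := by
        refine mul_le_mul_of_nonneg_left ?_ hc
        rw [← hb.summable.sum_add_tsum_nat_add s]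
        exact le_add_of_nonneg_left (Finset.sum_nonneg fun _ _ => hb0 _)

theorem IsShift.norm_apply_le (hT : IsShift O T) {ψ : FiniteParticle D m} {N : ℕ}
    (hψ : AtMost N (ψ : Fock D m)) {C : ℝ} (hC : 0 ≤ C)
    (hO : ∀ n x, n + s ≤ N → ‖O n x‖ ≤ C * ‖x‖) : ‖T ψ‖ ≤ C * ‖ψ‖ := by
  have hterm : ∀ n, ‖(T ψ : Fock D m) (n + r)‖ ^ 2 ≤ C ^ 2 * ‖(ψ : Fock D m) (n + s)‖ ^ 2 := by
    intro n
    rw [hT.apply_add, ← mul_pow]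
    by_cases h : n + s ≤ N
    · gcongr
      exact hO n _ h
    · rw [hψ _ (by omega), map_zero]; simp
  have hsq : ‖(T ψ : Fock D m)‖ ^ 2 ≤ C ^ 2 * ‖(ψ : Fock D m)‖ ^ 2 :=
    le_mul_of_hasSum_shift (hasSum_norm_sq _) (hasSum_norm_sq _) (sq_nonneg C)
      (fun _ => sq_nonneg _) (fun j hj => by rw [hT.apply_of_lt ψ j hj]; simp) hterm
  rw [← mul_pow] at hsq
  exact (sq_le_sq₀ (norm_nonneg _) (mul_nonneg hC (norm_nonneg _))).mp hsq

/-- The terms below `r` on the left and below `s` on the right vanish; the remaining ones match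
index by index. -/
theorem IsShift.inner_left (hT : IsShift O T)
    {O' : ∀ n, NParticle D m (n + r) →ₗ[ℂ] NParticle D m (n + s)}
    {T' : Module.End ℂ (FiniteParticle D m)} (hT' : IsShift O' T')
    (hO : ∀ n x y, ⟪O n x, y⟫_ℂ = ⟪x, O' n y⟫_ℂ) (ψ φ : FiniteParticle D m) :
    ⟪(T ψ : Fock D m), (φ : Fock D m)⟫_ℂ = ⟪(ψ : Fock D m), (T' φ : Fock D m)⟫_ℂ := by
  have h1 := lp.hasSum_inner (𝕜 := ℂ) (T ψ : Fock D m) (φ : Fock D m)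
  have h2 := lp.hasSum_inner (𝕜 := ℂ) (ψ : Fock D m) (T' φ : Fock D m)
  rw [← h1.tsum_eq, ← h2.tsum_eq, ← h1.summable.sum_add_tsum_nat_add r,
    ← h2.summable.sum_add_tsum_nat_add s, Finset.sum_eq_zero, Finset.sum_eq_zero]
  · congr 1
    refine tsum_congr fun n => ?_
    rw [hT.apply_add, hT'.apply_add, hO]
  · intro j hj
    rw [hT'.apply_of_lt φ j (Finset.mem_range.mp hj), inner_zero_right]
  · intro j hj
    rw [hT.apply_of_lt ψ j (Finset.mem_range.mp hj), inner_zero_left]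

/-- Truncations of a vector converge to it in the Hilbert sum. -/
theorem dense_finiteParticle (D : ℕ) (m : ℝ) :
    Dense (FiniteParticle D m : Set (Fock D m)) := by
  intro ψ
  have h := lp.hasSum_single (p := 2) (by norm_num) ψ
  refine mem_closure_of_tendsto h (Filter.Eventually.of_forall fun s => ?_)
  refine Submodule.sum_mem _ fun n _ => ⟨n, fun l hl => ?_⟩
  exact lp.single_apply_ne 2 n _ hl.ne'

end Shift

/-! ### Normalization of the sector operators -/

namespace Extraction

variable {D : ℕ} {m : ℝ} {N N' n : ℕ} {X X' : Type} [MeasurableSpace X] [MeasurableSpace X']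
  {ρ : Measure X} {ρ' : Measure X'} [SigmaFinite ρ] [SigmaFinite ρ'] {E E' : Type}
  [Fintype E] [Fintype E'] (A : Extraction D m N n ρ E) (B : Extraction D m N' n ρ' E')

/-- Used to turn the integral over a pair of momenta into an iterated one; it is available only for
almost every `P`. -/
theorem ae_integrable_wickOp {k : X' → X → ℂ} {C : ℝ≥0} (hk : IsBoundedKernel ρ' ρ k C)
    (g : NParticle D m N) (e : E') : ∀ᵐ P ∂(shellPi D m N'),
      Integrable (fun x => k (B.proj e P).1 x *
        (g : Lp ℂ 2 (shellPi D m N)) (A.insert (x, (B.proj e P).2))) ρ := by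
  have hq := (B.measurePreserving_proj e).quasiMeasurePreserving
  have h1 := (Measure.quasiMeasurePreserving_snd (μ := ρ') (ν := shellPi D m n)).ae
    (ae_ae_swap (coeFn_pull A.measurePreserving_insert (g : Lp ℂ 2 (shellPi D m N))))
  filter_upwards [hq.ae (hk.ae_integrable (pull A.measurePreserving_insert
    (g : Lp ℂ 2 (shellPi D m N)))), hq.ae h1] with P h2 h3
  refine h2.congr ?_
  filter_upwards [h3] with x hx
  rw [hx]
  rfl

/-- The operator `wickOp` with the normalization of creation and annihilation operators. -/
def normOp {k : X' → X → ℂ} {C : ℝ≥0} (hk : IsBoundedKernel ρ' ρ k C) :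
    NParticle D m N →ₗ[ℂ] NParticle D m N' :=
  ((√(Fintype.card E) / √(Fintype.card E') : ℝ) : ℂ) • A.wickOp B hk

/-- In the cases used, the product of square roots is `√(n + 1)`, `n + 1` or `√((n + 2) (n + 1))`:
growth at most linear in the particle number. -/
theorem norm_normOp_le [Nonempty E'] {k : X' → X → ℂ} {C : ℝ≥0} (hk : IsBoundedKernel ρ' ρ k C)
    (g : NParticle D m N) :
    ‖A.normOp B hk g‖ ≤ √(Fintype.card E) * √(Fintype.card E') * C * ‖g‖ := by
  rw [normOp, LinearMap.smul_apply, norm_smul, Complex.norm_of_nonneg (by positivity)]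
  have hb : 0 < √(Fintype.card E' : ℝ) := Real.sqrt_pos.mpr (by exact_mod_cast Fintype.card_pos)
  calc _ ≤ √(Fintype.card E) / √(Fintype.card E') * (Fintype.card E' * C * ‖g‖) := by
        gcongr; exact A.norm_wickOp_le B hk g
    _ = √(Fintype.card E) / √(Fintype.card E') *
        (√(Fintype.card E') * √(Fintype.card E') * C * ‖g‖) := by
        rw [Real.mul_self_sqrt (Nat.cast_nonneg _)]
    _ = _ := by field_simp

theorem inner_normOp_left [Nonempty E] [Nonempty E'] {k : X' → X → ℂ} {k' : X → X' → ℂ}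
    {C C' : ℝ≥0} (hk : IsBoundedKernel ρ' ρ k C) (hk' : IsBoundedKernel ρ ρ' k' C')
    (hkk : ∀ x x', k' x x' = conj (k x' x)) (g : NParticle D m N) (w : NParticle D m N') :
    ⟪A.normOp B hk g, w⟫_ℂ = ⟪g, B.normOp A hk' w⟫_ℂ := by
  have h := A.inner_wickOp_left B hk hk' hkk g w
  have ha : 0 < √(Fintype.card E : ℝ) := Real.sqrt_pos.mpr (by exact_mod_cast Fintype.card_pos)
  have hb : 0 < √(Fintype.card E' : ℝ) := Real.sqrt_pos.mpr (by exact_mod_cast Fintype.card_pos)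
  have ea : (Fintype.card E : ℂ) = (√(Fintype.card E : ℝ) : ℂ) * (√(Fintype.card E : ℝ) : ℂ) := by
    rw [← Complex.ofReal_mul, Real.mul_self_sqrt (Nat.cast_nonneg _), Complex.ofReal_natCast]
  have eb : (Fintype.card E' : ℂ) = (√(Fintype.card E' : ℝ) : ℂ) * (√(Fintype.card E' : ℝ) : ℂ) := by
    rw [← Complex.ofReal_mul, Real.mul_self_sqrt (Nat.cast_nonneg _), Complex.ofReal_natCast]
  rw [ea, eb] at h
  have ha' : (√(Fintype.card E : ℝ) : ℂ) ≠ 0 := by exact_mod_cast ha.ne'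
  have hb' : (√(Fintype.card E' : ℝ) : ℂ) ≠ 0 := by exact_mod_cast hb.ne'
  simp only [normOp, LinearMap.smul_apply, inner_smul_left, inner_smul_right, Complex.ofReal_div,
    map_div₀, Complex.conj_ofReal]
  field_simp
  linear_combination h

theorem coeFn_normOp {k : X' → X → ℂ} {C : ℝ≥0} (hk : IsBoundedKernel ρ' ρ k C)
    (g : NParticle D m N) : (A.normOp B hk g : Lp ℂ 2 (shellPi D m N')) =ᵐ[shellPi D m N'] fun P =>
      ((√(Fintype.card E) / √(Fintype.card E') : ℝ) : ℂ) * ∑ e, ∫ x, k (B.proj e P).1 x *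
        (g : Lp ℂ 2 (shellPi D m N)) (A.insert (x, (B.proj e P).2)) ∂ρ := by
  rw [normOp, LinearMap.smul_apply, Submodule.coe_smul]
  filter_upwards [Lp.coeFn_smul ((√(Fintype.card E) / √(Fintype.card E') : ℝ) : ℂ)
    (A.wickOp B hk g : Lp ℂ 2 (shellPi D m N')), A.coeFn_wickOp B hk g] with P h1 h2
  rw [h1, Pi.smul_apply, h2, smul_eq_mul]

end Extraction

/-! ### Wave functions of the elementary operators -/

section Formulas

variable {X : Type} [MeasurableSpace X] {ρ : Measure X} [SigmaFinite ρ] {D : ℕ} {m : ℝ} {C : ℝ≥0}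

theorem isBoundedKernel_row {u : X → ℂ} (hu : StronglyMeasurable u)
    (hC : ∫⁻ x, ‖u x‖ₑ ^ 2 ∂ρ ≤ (C : ℝ≥0∞) ^ 2) :
    IsBoundedKernel (Measure.dirac ()) ρ (fun _ : Unit => u) C :=
  isBoundedKernel_of_hilbertSchmidt (hu.comp_measurable measurable_snd) (by simpa using hC)

theorem isBoundedKernel_column {u : X → ℂ} (hu : StronglyMeasurable u)
    (hC : ∫⁻ x, ‖u x‖ₑ ^ 2 ∂ρ ≤ (C : ℝ≥0∞) ^ 2) :
    IsBoundedKernel ρ (Measure.dirac ()) (fun x (_ : Unit) => u x) C :=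
  isBoundedKernel_of_hilbertSchmidt (hu.comp_measurable measurable_fst) (by simpa using hC)

theorem wave_annOp {u : Momentum D → ℂ}
    (hk : IsBoundedKernel (Measure.dirac ()) (shellMeasure D m) (fun _ : Unit => u) C)
    {T : Module.End ℂ (FiniteParticle D m)}
    (hT : IsShift (r := 0) (s := 1) (fun n => (extractOne D m n).normOp (extractNone D m n) hk) T)
    (ψ : FiniteParticle D m) (n : ℕ) :
    wave (T ψ : Fock D m) n =ᵐ[shellPi D m n] annTerm u (ψ : Fock D m) n := by
  have h := (extractOne D m n).coeFn_normOp (extractNone D m n) hk ((ψ : Fock D m) (n + 1))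
  have e := hT.apply_add ψ n
  simp only [Nat.add_zero] at e
  rw [wave, e]
  filter_upwards [h] with P hP
  rw [hP]
  simp [annTerm, extractOne, extractNone, wave]

theorem wave_creOp {u : Momentum D → ℂ}
    (hk : IsBoundedKernel (shellMeasure D m) (Measure.dirac ()) (fun x (_ : Unit) => u x) C)
    {T : Module.End ℂ (FiniteParticle D m)}
    (hT : IsShift (r := 1) (s := 0) (fun n => (extractNone D m n).normOp (extractOne D m n) hk) T)
    (ψ : FiniteParticle D m) (n : ℕ) :
    wave (T ψ : Fock D m) n =ᵐ[shellPi D m n] creTerm u (ψ : Fock D m) n := by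
  cases n with
  | zero =>
    rw [wave, hT.apply_of_lt ψ 0 Nat.zero_lt_one]
    exact Lp.coeFn_zero _ _ _
  | succ n =>
    have h := (extractNone D m n).coeFn_normOp (extractOne D m n) hk ((ψ : Fock D m) n)
    have e := hT.apply_add ψ n
    simp only [Nat.add_zero] at e
    rw [wave, e]
    filter_upwards [h] with P hP
    rw [hP]
    simp [creTerm, extractOne, extractNone, wave]

/-- The kernel of the pair annihilation operator of the Wick square. -/
def annAnnKernel (m : ℝ) (h : SchwartzMap (Spacetime D) ℂ) (z : Momentum D × Momentum D) : ℂ :=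
  fourierM h (-energy D m z.1 - energy D m z.2) (-z.1 - z.2)

/-- The kernel of the number preserving part of the Wick square. -/
def creAnnKernel (m : ℝ) (h : SchwartzMap (Spacetime D) ℂ) (p q : Momentum D) : ℂ :=
  fourierM h (energy D m p - energy D m q) (p - q)

/-- The kernel of the pair creation operator of the Wick square. -/
def creCreKernel (m : ℝ) (h : SchwartzMap (Spacetime D) ℂ) (z : Momentum D × Momentum D) : ℂ :=
  fourierM h (energy D m z.1 + energy D m z.2) (z.1 + z.2)

theorem wave_annAnnOp {h : SchwartzMap (Spacetime D) ℂ}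
    (hk : IsBoundedKernel (Measure.dirac ()) ((shellMeasure D m).prod (shellMeasure D m))
      (fun _ : Unit => annAnnKernel m h) C)
    {T : Module.End ℂ (FiniteParticle D m)}
    (hT : IsShift (r := 0) (s := 2) (fun n => (extractTwo D m n).normOp (extractNone D m n) hk) T)
    (ψ : FiniteParticle D m) (n : ℕ) :
    wave (T ψ : Fock D m) n =ᵐ[shellPi D m n] annAnnTerm h (ψ : Fock D m) n := by
  have h1 := (extractTwo D m n).coeFn_normOp (extractNone D m n) hk ((ψ : Fock D m) (n + 2))
  have h2 := (extractTwo D m n).ae_integrable_wickOp (extractNone D m n) hk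
    ((ψ : Fock D m) (n + 2)) ()
  have e := hT.apply_add ψ n
  simp only [Nat.add_zero] at e
  rw [wave, e]
  filter_upwards [h1, h2] with P hP hI
  rw [hP, Fintype.sum_unique]
  have h3 := integral_prod _ hI
  have hc : (√(Fintype.card (Fin (n + 2) × Fin (n + 1)) : ℝ) / √(Fintype.card Unit : ℝ))
      = √(((n : ℝ) + 1) * (n + 2)) := by
    simp only [Fintype.card_prod, Fintype.card_fin, Fintype.card_unit, Nat.cast_one, Real.sqrt_one,
      div_one]
    congr 1
    push_cast
    ring
  rw [hc]
  exact congrArg _ h3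

theorem wave_creCreOp {h : SchwartzMap (Spacetime D) ℂ}
    (hk : IsBoundedKernel ((shellMeasure D m).prod (shellMeasure D m)) (Measure.dirac ())
      (fun z (_ : Unit) => creCreKernel m h z) C)
    {T : Module.End ℂ (FiniteParticle D m)}
    (hT : IsShift (r := 2) (s := 0) (fun n => (extractNone D m n).normOp (extractTwo D m n) hk) T)
    (ψ : FiniteParticle D m) (n : ℕ) :
    wave (T ψ : Fock D m) n =ᵐ[shellPi D m n] creCreTerm h (ψ : Fock D m) n := by
  match n with
  | 0 =>
    rw [wave, hT.apply_of_lt ψ 0 (by norm_num)]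
    exact Lp.coeFn_zero _ _ _
  | 1 =>
    rw [wave, hT.apply_of_lt ψ 1 (by norm_num)]
    exact Lp.coeFn_zero _ _ _
  | n + 2 =>
    have h1 := (extractNone D m n).coeFn_normOp (extractTwo D m n) hk ((ψ : Fock D m) n)
    have e := hT.apply_add ψ n
    simp only [Nat.add_zero] at e
    rw [wave, e]
    filter_upwards [h1] with P hP
    rw [hP]
    have hc : (√(Fintype.card Unit : ℝ) / √(Fintype.card (Fin (n + 2) × Fin (n + 1)) : ℝ))
        = (√(((n : ℝ) + 1) * (n + 2)))⁻¹ := by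
      simp only [Fintype.card_prod, Fintype.card_fin, Fintype.card_unit, Nat.cast_one,
        Real.sqrt_one, one_div]
      congr 2
      push_cast
      ring
    rw [hc, Complex.ofReal_inv, Fintype.sum_prod_type]
    simp only [integral_dirac]
    rfl

/-- A wave function is symmetric only almost everywhere, whereas `creAnnTerm` replaces an argument
in place and `insert` puts it in front. Fubini in the splitting of the argument `i` from the others
makes the two agree for almost every `P` and then almost every `q`. -/
theorem ae_update_eq_cons {n : ℕ} (g : NParticle D m (n + 1)) (i : Fin (n + 1)) :
    ∀ᵐ P ∂(shellPi D m (n + 1)), ∀ᵐ q ∂(shellMeasure D m),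
      (g : Lp ℂ 2 (shellPi D m (n + 1))) (Function.update P i q) =
        (g : Lp ℂ 2 (shellPi D m (n + 1))) (Matrix.vecCons q fun l => P (i.succAbove l)) := by
  obtain ⟨σ, hσ⟩ := (extractOne D m n).insert_proj i
  have hmp := measurePreserving_piFinSuccAbove (fun _ : Fin (n + 1) => shellMeasure D m) i
  have h1 := coeFn_pull (measurePreserving_perm D m (n + 1) σ) (g : Lp ℂ 2 (shellPi D m (n + 1)))
  rw [mem_NParticle_iff.mp g.2 σ] at h1
  have h2 := ae_ae_swap (hmp.symm.quasiMeasurePreserving.ae h1)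
  have h3 := hmp.quasiMeasurePreserving.ae
    ((Measure.quasiMeasurePreserving_snd (μ := shellMeasure D m) (ν := shellPi D m n)).ae h2)
  filter_upwards [h3] with P hP
  filter_upwards [hP] with q hq
  have e1 : (MeasurableEquiv.piFinSuccAbove (fun _ : Fin (n + 1) => Momentum D) i).symm
      (q, (MeasurableEquiv.piFinSuccAbove (fun _ : Fin (n + 1) => Momentum D) i P).2)
        = Function.update P i q := by
    change Fin.insertNth (α := fun _ => Momentum D) i q (fun l => P (i.succAbove l)) = _
    exact Fin.insertNth_removeNth i q P
  rw [e1] at hq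
  have e2 : (extractOne D m n).proj i (Function.update P i q)
      = (q, fun l => P (i.succAbove l)) := by
    simp [extractOne]
  rw [hq, Function.comp_apply, ← hσ, e2]
  rfl

theorem wave_creAnnOp {h : SchwartzMap (Spacetime D) ℂ}
    (hk : IsBoundedKernel (shellMeasure D m) (shellMeasure D m) (creAnnKernel m h) C)
    {T : Module.End ℂ (FiniteParticle D m)}
    (hT : IsShift (r := 1) (s := 1) (fun n => (extractOne D m n).normOp (extractOne D m n) hk) T)
    (ψ : FiniteParticle D m) (n : ℕ) :
    wave (T ψ : Fock D m) n =ᵐ[shellPi D m n] creAnnTerm h (ψ : Fock D m) n := by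
  cases n with
  | zero =>
    rw [wave, hT.apply_of_lt ψ 0 Nat.zero_lt_one]
    filter_upwards [Lp.coeFn_zero ℂ 2 (shellPi D m 0)] with P hP
    refine hP.trans ?_
    simp [creAnnTerm]
  | succ n =>
    have h1 := (extractOne D m n).coeFn_normOp (extractOne D m n) hk ((ψ : Fock D m) (n + 1))
    rw [wave, hT.apply_add ψ n]
    filter_upwards [h1, ae_all_iff.mpr (ae_update_eq_cons ((ψ : Fock D m) (n + 1)))] with P hP hu
    rw [hP, div_self (by simp; positivity), Complex.ofReal_one, one_mul]
    refine Finset.sum_congr rfl fun i _ => integral_congr_ae ?_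
    filter_upwards [hu i] with q hq
    exact congrArg _ hq.symm

end Formulas

/-! ### Decay of the Fourier transform -/

section Fourier

variable {D : ℕ}

/-- The point at which the standard Fourier transform equals `fourierM h k0 k`. -/
def fourierPoint (k0 : ℝ) (k : Momentum D) : Spacetime D :=
  WithLp.toLp 2 (Fin.cons (-((2 * Real.pi)⁻¹ * k0)) fun i => (2 * Real.pi)⁻¹ * k i)

theorem fourierM_eq_fourier (h : SchwartzMap (Spacetime D) ℂ) (k0 : ℝ) (k : Momentum D) :
    fourierM h k0 k = 𝓕 h (fourierPoint k0 k) := by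
  rw [SchwartzMap.fourier_coe, Real.fourier_eq', fourierM]
  refine integral_congr_ae (Filter.Eventually.of_forall fun x => ?_)
  have hπ : (Real.pi : ℝ) ≠ 0 := Real.pi_ne_zero
  have hin : -2 * Real.pi * ⟪x, fourierPoint k0 k⟫_ℝ
      = -(-(k0 * x 0) + ∑ i : Fin D, k i * x i.succ) := by
    rw [PiLp.inner_apply, Fin.sum_univ_succ]
    simp only [fourierPoint, Fin.cons_zero, Fin.cons_succ, RCLike.inner_apply, conj_trivial]
    rw [mul_add, Finset.mul_sum, neg_add, ← Finset.sum_neg_distrib]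
    congr 1
    · field_simp
    · refine Finset.sum_congr rfl fun i _ => ?_
      field_simp
  simp only [hin, smul_eq_mul]
  rw [mul_comm]
  congr 2
  push_cast
  ring

theorem continuous_fourierPoint :
    Continuous fun z : ℝ × Momentum D => fourierPoint z.1 z.2 := by
  refine (PiLp.continuous_toLp 2 _).comp (continuous_pi fun i => ?_)
  refine Fin.cases ?_ (fun j => ?_) i
  · simp only [Fin.cons_zero]; fun_prop
  · simp only [Fin.cons_succ]; fun_prop

theorem continuous_fourierM (h : SchwartzMap (Spacetime D) ℂ) :
    Continuous fun z : ℝ × Momentum D => fourierM h z.1 z.2 := by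
  simp_rw [fourierM_eq_fourier]
  exact (𝓕 h).continuous.comp continuous_fourierPoint

theorem norm_sq_fourierPoint (k0 : ℝ) (k : Momentum D) :
    ‖fourierPoint k0 k‖ ^ 2 = ((2 * Real.pi)⁻¹) ^ 2 * (k0 ^ 2 + ‖k‖ ^ 2) := by
  rw [EuclideanSpace.norm_sq_eq, EuclideanSpace.norm_sq_eq, Fin.sum_univ_succ]
  simp only [fourierPoint, Fin.cons_zero, Fin.cons_succ, Real.norm_eq_abs, sq_abs]
  rw [mul_add, Finset.mul_sum]
  congr 1
  · ring
  · exact Finset.sum_congr rfl fun i _ => by ring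

theorem le_two_pi_mul_one_add_norm_fourierPoint (k0 : ℝ) (k : Momentum D) {a : ℝ} (ha : 0 ≤ a)
    (h : a ^ 2 ≤ k0 ^ 2 + ‖k‖ ^ 2) : 1 + a ≤ 2 * Real.pi * (1 + ‖fourierPoint k0 k‖) := by
  have hπ := Real.pi_gt_three
  have h1 : a ≤ 2 * Real.pi * ‖fourierPoint k0 k‖ := by
    refine (sq_le_sq₀ ha (by positivity)).mp (h.trans_eq ?_)
    rw [mul_pow, norm_sq_fourierPoint]
    field_simp
  linarith

/-- The free number `a` permits decay in any quantity dominated by the length of `(k0, k)`: the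
total momentum for `cConst`, the sum of two momentum norms for `pairNorm`. -/
theorem fourierM_decay (h : SchwartzMap (Spacetime D) ℂ) (N : ℕ) :
    ∃ C : ℝ, 0 ≤ C ∧ ∀ (k0 : ℝ) (k : Momentum D) (a : ℝ), 0 ≤ a → a ^ 2 ≤ k0 ^ 2 + ‖k‖ ^ 2 →
      (1 + a) ^ N * ‖fourierM h k0 k‖ ≤ C := by
  have hd := fun x => SchwartzMap.one_add_le_sup_seminorm_apply (𝕜 := ℂ) (m := (N, 0)) (k := N)
    (n := 0) le_rfl le_rfl (𝓕 h) x
  set B := 2 ^ N * ((Finset.Iic (N, 0)).sup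
    (fun m : ℕ × ℕ => SchwartzMap.seminorm ℂ (E := Spacetime D) (F := ℂ) m.1 m.2)) (𝓕 h)
  have hB : 0 ≤ B := by positivity
  refine ⟨(2 * Real.pi) ^ N * B, by positivity, fun k0 k a ha hak => ?_⟩
  have h1 := hd (fourierPoint k0 k)
  rw [norm_iteratedFDeriv_zero] at h1
  rw [fourierM_eq_fourier]
  calc (1 + a) ^ N * ‖𝓕 h (fourierPoint k0 k)‖
      ≤ (2 * Real.pi * (1 + ‖fourierPoint k0 k‖)) ^ N * ‖𝓕 h (fourierPoint k0 k)‖ := by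
        gcongr
        exact le_two_pi_mul_one_add_norm_fourierPoint k0 k ha hak
    _ = (2 * Real.pi) ^ N * ((1 + ‖fourierPoint k0 k‖) ^ N * ‖𝓕 h (fourierPoint k0 k)‖) := by
        rw [mul_pow]; ring
    _ ≤ _ := by gcongr

theorem fourierM_smul (β : ℂ) (h : SchwartzMap (Spacetime D) ℂ) (k0 : ℝ) (k : Momentum D) :
    fourierM (β • h) k0 k = β * fourierM h k0 k := by
  rw [fourierM, fourierM, ← integral_const_mul]
  simp only [smul_apply, smul_eq_mul, mul_assoc]

/-- For real `h` this makes the kernels of `a a` and `a† a†` conjugate to each other and that of `a†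
a` Hermitian. -/
theorem conj_fourierM {h : SchwartzMap (Spacetime D) ℂ} (hh : ∀ x, (h x).im = 0) (k0 : ℝ)
    (k : Momentum D) : conj (fourierM h k0 k) = fourierM h (-k0) (-k) := by
  rw [fourierM, fourierM, ← integral_conj]
  refine integral_congr_ae (Filter.Eventually.of_forall fun x => ?_)
  simp only [map_mul, Complex.conj_eq_iff_im.mpr (hh x), ← Complex.exp_conj, map_neg,
    Complex.conj_I, Complex.conj_ofReal, neg_neg]
  congr 2
  simp only [PiLp.neg_apply, neg_mul, Finset.sum_neg_distrib]
  push_cast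
  ring

end Fourier

/-! ### The mass shell -/

section MassShell

variable {D : ℕ} {m : ℝ}

theorem continuous_energy (D : ℕ) (m : ℝ) : Continuous (energy D m) := by
  unfold energy
  fun_prop

theorem le_energy (p : Momentum D) : m ≤ energy D m p :=
  Real.le_sqrt_of_sq_le (le_add_of_nonneg_right (sq_nonneg _))

theorem energy_pos (hm : 0 < m) (p : Momentum D) : 0 < energy D m p := hm.trans_le (le_energy p)

theorem norm_le_energy (p : Momentum D) : ‖p‖ ≤ energy D m p :=
  Real.le_sqrt_of_sq_le (le_add_of_nonneg_left (sq_nonneg _))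

theorem energy_neg (p : Momentum D) : energy D m (-p) = energy D m p := by
  simp [energy]

theorem energy_le (hm : 0 < m) (p : Momentum D) : energy D m p ≤ (m + 1) * (1 + ‖p‖) := by
  refine Real.sqrt_le_iff.mpr ⟨by positivity, ?_⟩
  have h1 : m ^ 2 + ‖p‖ ^ 2 ≤ (m + ‖p‖) ^ 2 := by nlinarith [norm_nonneg p]
  refine h1.trans (pow_le_pow_left₀ (by positivity) ?_ 2)
  nlinarith [norm_nonneg p]

/-- The upper bound of the density of the measure on the mass shell. -/
def shellBound (D : ℕ) (m : ℝ) : ℝ := 1 / (2 * m * (2 * Real.pi) ^ D)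

theorem measurable_shellDensity (D : ℕ) (m : ℝ) : Measurable fun p : Momentum D =>
    ENNReal.ofReal (1 / (2 * energy D m p * (2 * Real.pi) ^ D)) := by
  have := (continuous_energy D m).measurable
  fun_prop

theorem shellMeasure_le (hm : 0 < m) :
    shellMeasure D m ≤ ENNReal.ofReal (shellBound D m) • (volume : Measure (Momentum D)) := by
  rw [shellMeasure, ← withDensity_const]
  refine withDensity_mono (Filter.Eventually.of_forall fun p => ENNReal.ofReal_le_ofReal ?_)
  have := le_energy (m := m) p
  have := Real.pi_pos
  rw [shellBound]
  gcongr

theorem lintegral_neg_shellMeasure {g : Momentum D → ℝ≥0∞} (hg : Measurable g) :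
    ∫⁻ p, g (-p) ∂(shellMeasure D m) = ∫⁻ p, g p ∂(shellMeasure D m) := by
  rw [shellMeasure, lintegral_withDensity_eq_lintegral_mul _ (measurable_shellDensity D m) hg,
    lintegral_withDensity_eq_lintegral_mul _ (measurable_shellDensity D m)
      (show Measurable fun p => g (-p) from hg.comp measurable_neg), ← lintegral_neg_eq_self]
  simp [energy_neg]

theorem integrable_shellMeasure_one_add_norm (hm : 0 < m) :
    Integrable (fun p : Momentum D => ((1 + ‖p‖) ^ (D + 1))⁻¹) (shellMeasure D m) := by
  have h := integrable_one_add_norm (E := Momentum D) (μ := volume) (r := D + 1) (by simp)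
  have h2 : Integrable (fun p : Momentum D => ((1 + ‖p‖) ^ (D + 1))⁻¹)
      (volume : Measure (Momentum D)) := by
    refine h.congr (Filter.Eventually.of_forall fun p => ?_)
    have hp : 0 ≤ 1 + ‖p‖ := by positivity
    simp only
    rw [Real.rpow_neg hp]
    exact_mod_cast rfl
  exact (h2.smul_measure ENNReal.ofReal_ne_top).mono_measure (shellMeasure_le hm)

/-- The ball lies in the cube `(-1, 1)^D`. The factor `2 ^ D` will cancel against `(2π) ^ D` in the
shell measure. -/
theorem volume_real_unitBall_le (D : ℕ) :
    (volume : Measure (Momentum D)).real (Metric.ball 0 1) ≤ 2 ^ D := by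
  have hsub : Metric.ball (0 : Momentum D) 1 ⊆
      (WithLp.ofLp (p := 2)) ⁻¹' (Set.univ.pi fun _ : Fin D => Set.Ioo (-1 : ℝ) 1) := by
    intro x hx i _
    rw [mem_ball_zero_iff] at hx
    have h1 := (PiLp.norm_apply_le x i).trans_lt hx
    rw [Real.norm_eq_abs, abs_lt] at h1
    exact h1
  have hv : (volume : Measure (Momentum D)) ((WithLp.ofLp (p := 2)) ⁻¹'
      (Set.univ.pi fun _ : Fin D => Set.Ioo (-1 : ℝ) 1)) = 2 ^ D := by
    rw [(PiLp.volume_preserving_ofLp (Fin D)).measure_preimage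
      (MeasurableSet.univ_pi fun _ => measurableSet_Ioo).nullMeasurableSet, volume_pi_pi]
    simp only [Real.volume_Ioo]
    norm_num
  have h := measure_mono (μ := volume) hsub
  rw [hv] at h
  have h2 := ENNReal.toReal_mono (by simp) h
  simpa [Measure.real] using h2

theorem integrableOn_inv_sq_add_sq (hm : 0 < m) :
    IntegrableOn (fun r : ℝ => (m ^ 2 + r ^ 2)⁻¹) (Set.Ioi 0) ∧
      ∫ r in Set.Ioi (0 : ℝ), (m ^ 2 + r ^ 2)⁻¹ = Real.pi / (2 * m) := by
  have e : ∀ r : ℝ, (m ^ 2 + r ^ 2)⁻¹ = (m ^ 2)⁻¹ * (1 + (m⁻¹ * r) ^ 2)⁻¹ := fun r => by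
    have h1 : m ^ 2 + r ^ 2 ≠ 0 := by positivity
    have h2 : 1 + (m⁻¹ * r) ^ 2 ≠ 0 := by positivity
    rw [← mul_inv]
    congr 1
    field_simp
  simp_rw [e]
  constructor
  · refine Integrable.const_mul ?_ _
    refine (integrableOn_Ioi_comp_mul_left_iff (fun x => (1 + x ^ 2)⁻¹) 0 (inv_pos.mpr hm)).mpr ?_
    exact integrable_inv_one_add_sq.integrableOn
  · rw [integral_const_mul,
      integral_comp_mul_left_Ioi (fun x => (1 + x ^ 2)⁻¹) 0 (inv_pos.mpr hm)]
    simp only [mul_zero, integral_Ioi_inv_one_add_sq, Real.arctan_zero, sub_zero, inv_inv,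
      smul_eq_mul]
    field_simp

/-- In polar coordinates `r ^ (D - 1)` is at most the same power of the energy, leaving `1 / (m² +
r²)` with integral `π / (2m)`. -/
theorem integral_energy_inv_pow_le (hD : 1 ≤ D) (hm : 0 < m) :
    Integrable (fun p : Momentum D => (energy D m p ^ (D + 1))⁻¹) ∧
      ∫ p : Momentum D, (energy D m p ^ (D + 1))⁻¹ ≤ D * 2 ^ D * (Real.pi / (2 * m)) := by
  have : Nontrivial (Momentum D) := by
    have : Nonempty (Fin D) := ⟨⟨0, hD⟩⟩
    infer_instance
  obtain ⟨hi, hv⟩ := integrableOn_inv_sq_add_sq hm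
  let f : ℝ → ℝ := fun r => (√(m ^ 2 + r ^ 2) ^ (D + 1))⁻¹
  have hle : ∀ r ∈ Set.Ioi (0 : ℝ), r ^ (D - 1) • f r ≤ (m ^ 2 + r ^ 2)⁻¹ := by
    intro r hr
    have hr' : 0 < r := hr
    have hs : 0 < √(m ^ 2 + r ^ 2) := Real.sqrt_pos.mpr (by positivity)
    have hrs : r ≤ √(m ^ 2 + r ^ 2) := Real.le_sqrt_of_sq_le (by nlinarith)
    have h2 : √(m ^ 2 + r ^ 2) ^ 2 = m ^ 2 + r ^ 2 := Real.sq_sqrt (by positivity)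
    have h3 : √(m ^ 2 + r ^ 2) ^ (D + 1) = √(m ^ 2 + r ^ 2) ^ (D - 1) * (m ^ 2 + r ^ 2) := by
      have h4 : D + 1 = D - 1 + 2 := by omega
      rw [h4, pow_add, h2]
    simp only [f, smul_eq_mul]
    rw [h3, mul_inv, ← mul_assoc]
    refine mul_le_of_le_one_left (by positivity) ?_
    rw [← div_eq_mul_inv]
    exact div_le_one_of_le₀ (pow_le_pow_left₀ hr'.le hrs _) (by positivity)
  have hint : IntegrableOn (fun r : ℝ => r ^ (D - 1) • f r) (Set.Ioi 0) := by
    refine Integrable.mono' hi ?_ ?_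
    · refine Measurable.aestronglyMeasurable ?_
      simp only [f, smul_eq_mul]
      fun_prop
    · refine (ae_restrict_iff' measurableSet_Ioi).mpr (Filter.Eventually.of_forall fun r hr => ?_)
      have hr' : 0 < r := hr
      rw [Real.norm_of_nonneg (by simp only [f, smul_eq_mul]; positivity)]
      exact hle r hr
  have hdim : Module.finrank ℝ (Momentum D) = D := by simp
  constructor
  · refine (integrable_fun_norm_addHaar (volume : Measure (Momentum D)) (f := f)).mpr ?_
    rw [hdim]
    exact hint
  · have h := integral_fun_norm_addHaar (volume : Measure (Momentum D)) f
    rw [hdim] at h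
    change ∫ p : Momentum D, f ‖p‖ ≤ _
    rw [h, nsmul_eq_mul, smul_eq_mul, mul_assoc]
    have hI : ∫ r in Set.Ioi (0 : ℝ), r ^ (D - 1) • f r ≤ Real.pi / (2 * m) := by
      rw [← hv]
      exact setIntegral_mono_on hint hi measurableSet_Ioi hle
    have hI0 : 0 ≤ Real.pi / (2 * m) := by have := Real.pi_pos; positivity
    refine mul_le_mul_of_nonneg_left ?_ (Nat.cast_nonneg D)
    exact mul_le_mul (volume_real_unitBall_le D) hI (setIntegral_nonneg measurableSet_Ioi
      fun r hr => by have hr' : 0 < r := hr; simp only [f, smul_eq_mul]; positivity) (by positivity)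

theorem shellBound_mul_lintegral_energy_le (hD : 1 ≤ D) (hm : 0 < m) {c : ℝ} (hc : 0 ≤ c) :
    ENNReal.ofReal (shellBound D m) *
      ∫⁻ p : Momentum D, ENNReal.ofReal (c * m ^ 2 * (energy D m p ^ (D + 1))⁻¹)
        ≤ ENNReal.ofReal c := by
  obtain ⟨hi, hle⟩ := integral_energy_inv_pow_le hD hm
  have hπ := Real.pi_gt_three
  rw [← ofReal_integral_eq_lintegral_ofReal (hi.const_mul _)
    (Filter.Eventually.of_forall fun p => by have := energy_pos hm p; positivity),
    ← ENNReal.ofReal_mul (by rw [shellBound]; positivity), integral_const_mul]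
  refine ENNReal.ofReal_le_ofReal ?_
  -- All masses and powers of `2 ^ D` cancel, leaving the factor `D π / (4 π ^ D)`, which `D ≤ 2 ^
  -- (D - 1) ≤ π ^ (D - 1)` keeps below `1`.
  have h1 : (D : ℝ) * Real.pi ≤ 4 * Real.pi ^ D := by
    have h2 : (D : ℝ) ≤ 2 ^ (D - 1) := by
      have : D - 1 < 2 ^ (D - 1) := Nat.lt_two_pow_self
      have : D ≤ 2 ^ (D - 1) := by omega
      exact_mod_cast this
    have h3 : (2 : ℝ) ^ (D - 1) ≤ Real.pi ^ (D - 1) := by gcongr; linarith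
    have h4 : Real.pi ^ D = Real.pi ^ (D - 1) * Real.pi := by
      rw [← pow_succ]; congr 1; omega
    rw [h4]
    have : 0 ≤ Real.pi ^ (D - 1) := by positivity
    nlinarith
  calc shellBound D m * (c * m ^ 2 * ∫ p : Momentum D, (energy D m p ^ (D + 1))⁻¹)
      ≤ shellBound D m * (c * m ^ 2 * (D * 2 ^ D * (Real.pi / (2 * m)))) := by
        have : 0 ≤ shellBound D m := by rw [shellBound]; positivity
        gcongr
    _ = c * ((D * Real.pi) / (4 * Real.pi ^ D)) := by
        rw [shellBound, mul_pow]
        field_simp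
        ring
    _ ≤ c * 1 := by
        gcongr
        exact div_le_one_of_le₀ h1 (by positivity)
    _ = c := mul_one c

end MassShell

/-! ### The kernels of the Wick square -/

section WickKernels

variable {D : ℕ} {m : ℝ}

/-- Without boundedness `sSup` would be a default value. Decay in the momentum alone is enough,
uniformly in the energy argument. -/
theorem bddAbove_cConst (hm : 0 < m) (h : SchwartzMap (Spacetime D) ℂ) :
    BddAbove {y : ℝ | ∃ (p k : Momentum D) (s t : ℤˣ),
      y = energy D m p ^ (D + 1) / m ^ 2 *
        ‖fourierM h (((s : ℤ) : ℝ) * energy D m (p + k) + ((t : ℤ) : ℝ) * energy D m k) p‖} := by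
  obtain ⟨C, hC, hdec⟩ := fourierM_decay h (D + 1)
  refine ⟨(m + 1) ^ (D + 1) / m ^ 2 * C, ?_⟩
  rintro y ⟨p, k, s, t, rfl⟩
  have h1 := hdec (((s : ℤ) : ℝ) * energy D m (p + k) + ((t : ℤ) : ℝ) * energy D m k) p ‖p‖
    (norm_nonneg p) (le_add_of_nonneg_left (sq_nonneg _))
  have h2 : energy D m p ^ (D + 1) ≤ (m + 1) ^ (D + 1) * (1 + ‖p‖) ^ (D + 1) := by
    rw [← mul_pow]
    exact pow_le_pow_left₀ (energy_pos hm p).le (energy_le hm p) _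
  calc _ ≤ (m + 1) ^ (D + 1) * (1 + ‖p‖) ^ (D + 1) / m ^ 2 * ‖fourierM h
        (((s : ℤ) : ℝ) * energy D m (p + k) + ((t : ℤ) : ℝ) * energy D m k) p‖ := by gcongr
    _ = (m + 1) ^ (D + 1) / m ^ 2 * ((1 + ‖p‖) ^ (D + 1) * ‖fourierM h
        (((s : ℤ) : ℝ) * energy D m (p + k) + ((t : ℤ) : ℝ) * energy D m k) p‖) := by ring
    _ ≤ _ := by gcongr

theorem cConst_nonneg (hm : 0 < m) (h : SchwartzMap (Spacetime D) ℂ) : 0 ≤ cConst m h := by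
  refine Real.sSup_nonneg ?_
  rintro y ⟨p, k, s, t, rfl⟩
  have := energy_pos hm p
  positivity

theorem norm_creAnnKernel_le (hm : 0 < m) (h : SchwartzMap (Spacetime D) ℂ) (p q : Momentum D) :
    ‖creAnnKernel m h p q‖ ≤ cConst m h * m ^ 2 * (energy D m (p - q) ^ (D + 1))⁻¹ := by
  -- The total momentum is `p - q` over the base point `q`, with signs `+` and `-`.
  have h1 := le_csSup (bddAbove_cConst hm h) ⟨p - q, q, 1, -1, rfl⟩
  simp only [Units.val_one, Units.val_neg, Int.cast_one, Int.cast_neg, one_mul, neg_mul,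
    sub_add_cancel, ← sub_eq_add_neg] at h1
  have h2 := energy_pos hm (p - q)
  rw [← div_eq_mul_inv, le_div_iff₀ (by positivity)]
  rw [div_mul_eq_mul_div, div_le_iff₀ (by positivity), mul_comm] at h1
  exact h1

theorem stronglyMeasurable_creAnnKernel (m : ℝ) (h : SchwartzMap (Spacetime D) ℂ) :
    StronglyMeasurable (Function.uncurry (creAnnKernel m h)) := by
  refine Continuous.stronglyMeasurable ?_
  have hc := continuous_energy D m
  exact (continuous_fourierM h).comp (by fun_prop : Continuous fun z : Momentum D × Momentum D =>
    (energy D m z.1 - energy D m z.2, z.1 - z.2))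

/-- Schur's test: the majorant depends only on `p - q`, and passing from `μ` to Lebesgue measure
gives translation invariance, so rows and columns share one estimate. -/
theorem isBoundedKernel_creAnnKernel (hD : 1 ≤ D) (hm : 0 < m) (h : SchwartzMap (Spacetime D) ℂ) :
    IsBoundedKernel (shellMeasure D m) (shellMeasure D m) (creAnnKernel m h)
      (cConst m h).toNNReal := by
  have hb : ∀ p q : Momentum D, ‖creAnnKernel m h p q‖ₑ ≤
      ENNReal.ofReal (cConst m h * m ^ 2 * (energy D m (p - q) ^ (D + 1))⁻¹) := fun p q => by
    rw [← ofReal_norm]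
    exact ENNReal.ofReal_le_ofReal (norm_creAnnKernel_le hm h p q)
  have hs := shellBound_mul_lintegral_energy_le hD hm (cConst_nonneg hm h)
  have hm' : ∀ g : Momentum D → ℝ≥0∞, ∫⁻ p, g p ∂(shellMeasure D m) ≤
      ENNReal.ofReal (shellBound D m) * ∫⁻ p, g p := fun g => by
    rw [← smul_eq_mul, ← lintegral_smul_measure]
    exact lintegral_mono' (shellMeasure_le hm) le_rfl
  refine isBoundedKernel_of_schur (stronglyMeasurable_creAnnKernel m h) (fun p => ?_) (fun q => ?_)
  · refine (lintegral_mono (hb p)).trans ((hm' _).trans ?_)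
    rw [lintegral_sub_left_eq_self (fun x : Momentum D =>
      ENNReal.ofReal (cConst m h * m ^ 2 * (energy D m x ^ (D + 1))⁻¹)) p]
    exact hs
  · refine (lintegral_mono fun p => hb p q).trans ((hm' _).trans ?_)
    rw [lintegral_sub_right_eq_self (fun x : Momentum D =>
      ENNReal.ofReal (cConst m h * m ^ 2 * (energy D m x ^ (D + 1))⁻¹)) q]
    exact hs

/-- The kernel whose norm is `pairNorm`. -/
def pairKernel (m : ℝ) (h : SchwartzMap (Spacetime D) ℂ) (s : ℤˣ) (z : Momentum D × Momentum D) :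
    ℂ :=
  fourierM h (((s : ℤ) : ℝ) * (energy D m z.1 + energy D m z.2)) (z.1 + z.2)

theorem continuous_pairKernel (m : ℝ) (h : SchwartzMap (Spacetime D) ℂ) (s : ℤˣ) :
    Continuous (pairKernel m h s) := by
  have hc := continuous_energy D m
  exact (continuous_fourierM h).comp (by fun_prop : Continuous fun z : Momentum D × Momentum D =>
    (((s : ℤ) : ℝ) * (energy D m z.1 + energy D m z.2), z.1 + z.2))

/-- The two energies enter with the same sign, so the energy argument dominates `‖p‖ + ‖q‖` even
where `p + q` is small. This gives decay in both momenta separately. -/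
theorem integrable_norm_sq_pairKernel (hm : 0 < m) (h : SchwartzMap (Spacetime D) ℂ) (s : ℤˣ) :
    Integrable (fun z => ‖pairKernel m h s z‖ ^ 2) ((shellMeasure D m).prod (shellMeasure D m)) := by
  obtain ⟨C, hC, hdec⟩ := fourierM_decay h (D + 1)
  have hi := integrable_shellMeasure_one_add_norm (D := D) hm
  refine Integrable.mono' ((hi.mul_prod hi).const_mul (C ^ 2))
    (((continuous_pairKernel m h s).norm.pow 2).aestronglyMeasurable)
    (Filter.Eventually.of_forall fun z => ?_)
  have hs : (((s : ℤ) : ℝ)) ^ 2 = 1 := by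
    rcases Int.units_eq_one_or s with rfl | rfl <;> simp
  have e1 := energy_pos hm z.1
  have e2 := energy_pos hm z.2
  have n1 := norm_le_energy (m := m) z.1
  have n2 := norm_le_energy (m := m) z.2
  have h1 := hdec (((s : ℤ) : ℝ) * (energy D m z.1 + energy D m z.2)) (z.1 + z.2)
    (‖z.1‖ + ‖z.2‖) (by positivity) (by
      rw [mul_pow, hs, one_mul]
      exact le_add_of_le_of_nonneg (pow_le_pow_left₀ (by positivity) (add_le_add n1 n2) 2)
        (sq_nonneg _))
  have h2 : (1 + ‖z.1‖) * (1 + ‖z.2‖) ≤ (1 + (‖z.1‖ + ‖z.2‖)) ^ 2 := by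
    nlinarith [norm_nonneg z.1, norm_nonneg z.2, mul_nonneg (norm_nonneg z.1) (norm_nonneg z.2)]
  rw [Real.norm_of_nonneg (by positivity), ← mul_inv, ← mul_pow, ← div_eq_mul_inv,
    le_div_iff₀ (by positivity)]
  calc ‖pairKernel m h s z‖ ^ 2 * ((1 + ‖z.1‖) * (1 + ‖z.2‖)) ^ (D + 1)
      ≤ ‖pairKernel m h s z‖ ^ 2 * ((1 + (‖z.1‖ + ‖z.2‖)) ^ 2) ^ (D + 1) := by gcongr
    _ = ((1 + (‖z.1‖ + ‖z.2‖)) ^ (D + 1) * ‖pairKernel m h s z‖) ^ 2 := by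
        rw [mul_pow, ← pow_mul, ← pow_mul, mul_comm 2 (D + 1), mul_comm]
    _ ≤ C ^ 2 := by
        have := norm_nonneg (pairKernel m h s z)
        exact pow_le_pow_left₀ (by positivity) h1 2

theorem pairNorm_nonneg (m : ℝ) (h : SchwartzMap (Spacetime D) ℂ) (s : ℤˣ) : 0 ≤ pairNorm m h s :=
  Real.sqrt_nonneg _

theorem lintegral_enorm_sq_pairKernel (hm : 0 < m) (h : SchwartzMap (Spacetime D) ℂ) (s : ℤˣ) :
    ∫⁻ z, ‖pairKernel m h s z‖ₑ ^ 2 ∂((shellMeasure D m).prod (shellMeasure D m)) =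
      ((pairNorm m h s).toNNReal : ℝ≥0∞) ^ 2 := by
  have hi := integrable_norm_sq_pairKernel hm h s
  have h1 : pairNorm m h s ^ 2 =
      ∫ z, ‖pairKernel m h s z‖ ^ 2 ∂((shellMeasure D m).prod (shellMeasure D m)) := by
    rw [pairNorm, Real.sq_sqrt (integral_nonneg fun p => integral_nonneg fun q => sq_nonneg _),
      integral_prod _ hi]
    rfl
  rw [← ENNReal.ofReal, ← ENNReal.ofReal_pow (pairNorm_nonneg m h s), h1,
    ofReal_integral_eq_lintegral_ofReal hi (Filter.Eventually.of_forall fun z => sq_nonneg _)]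
  refine lintegral_congr fun z => ?_
  rw [ENNReal.ofReal_pow (norm_nonneg _), ofReal_norm]

theorem creCreKernel_eq_pairKernel (m : ℝ) (h : SchwartzMap (Spacetime D) ℂ) :
    creCreKernel m h = pairKernel m h 1 := by
  funext z
  simp [creCreKernel, pairKernel]

theorem annAnnKernel_eq_pairKernel (m : ℝ) (h : SchwartzMap (Spacetime D) ℂ)
    (z : Momentum D × Momentum D) : annAnnKernel m h z = pairKernel m h (-1) (-z.1, -z.2) := by
  simp only [annAnnKernel, pairKernel, energy_neg, Units.val_neg, Units.val_one, Int.cast_neg,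
    Int.cast_one]
  congr 1
  ring

theorem isBoundedKernel_creCreKernel (hm : 0 < m) (h : SchwartzMap (Spacetime D) ℂ) :
    IsBoundedKernel ((shellMeasure D m).prod (shellMeasure D m)) (Measure.dirac ())
      (fun z (_ : Unit) => creCreKernel m h z) (pairNorm m h 1).toNNReal := by
  rw [creCreKernel_eq_pairKernel]
  exact isBoundedKernel_column (continuous_pairKernel m h 1).stronglyMeasurable
    (lintegral_enorm_sq_pairKernel hm h 1).le

/-- The kernel is `pairKernel` with sign `-1` at reflected momenta, and the shell measure is
reflection invariant. -/
theorem isBoundedKernel_annAnnKernel (hm : 0 < m) (h : SchwartzMap (Spacetime D) ℂ) :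
    IsBoundedKernel (Measure.dirac ()) ((shellMeasure D m).prod (shellMeasure D m))
      (fun _ : Unit => annAnnKernel m h) (pairNorm m h (-1)).toNNReal := by
  have hc := continuous_pairKernel m h (-1)
  have he : annAnnKernel m h = fun z => pairKernel m h (-1) (-z.1, -z.2) :=
    funext (annAnnKernel_eq_pairKernel m h)
  have hcn : Continuous fun z : Momentum D × Momentum D => pairKernel m h (-1) (-z.1, -z.2) :=
    hc.comp (by fun_prop)
  rw [he]
  refine isBoundedKernel_row hcn.stronglyMeasurable (le_of_eq ?_)
  rw [← lintegral_enorm_sq_pairKernel hm h (-1), lintegral_prod _ (by fun_prop),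
    lintegral_prod _ (by fun_prop)]
  have h1 : ∀ p : Momentum D,
      ∫⁻ q, ‖pairKernel m h (-1) (-p, -q)‖ₑ ^ 2 ∂(shellMeasure D m) =
        ∫⁻ q, ‖pairKernel m h (-1) (-p, q)‖ₑ ^ 2 ∂(shellMeasure D m) := fun p =>
    lintegral_neg_shellMeasure (g := fun q => ‖pairKernel m h (-1) (-p, q)‖ₑ ^ 2)
      ((hc.comp (by fun_prop : Continuous fun q => (-p, q))).measurable.enorm.pow_const 2)
  simp_rw [h1]
  refine lintegral_neg_shellMeasure
    (g := fun p => ∫⁻ q, ‖pairKernel m h (-1) (p, q)‖ₑ ^ 2 ∂(shellMeasure D m)) ?_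
  exact Measurable.lintegral_prod_right' (f := fun z => ‖pairKernel m h (-1) z‖ₑ ^ 2) (by fun_prop)

end WickKernels

/-! ### Bounds on the finite-particle space -/

section StepBound

variable {D : ℕ} {m : ℝ} {T S : Module.End ℂ (FiniteParticle D m)} {K L : ℝ}

/-- `T` adds at most two particles and its norm on vectors with at most `N` particles is at most
`(N + 1) K`. -/
structure StepBound (T : Module.End ℂ (FiniteParticle D m)) (K : ℝ) : Prop where
  atMost : ∀ (N : ℕ) (ψ : FiniteParticle D m), AtMost N (ψ : Fock D m) →
    AtMost (N + 2) (T ψ : Fock D m)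
  norm_le : ∀ (N : ℕ) (ψ : FiniteParticle D m), AtMost N (ψ : Fock D m) →
    ‖T ψ‖ ≤ (N + 1) * K * ‖ψ‖

theorem StepBound.add (hT : StepBound T K) (hS : StepBound S L) : StepBound (T + S) (K + L) where
  atMost N ψ h l hl := by
    change (T ψ : Fock D m) l + (S ψ : Fock D m) l = 0
    rw [hT.atMost N ψ h l hl, hS.atMost N ψ h l hl, add_zero]
  norm_le N ψ h := by
    refine (norm_add_le _ _).trans ((add_le_add (hT.norm_le N ψ h) (hS.norm_le N ψ h)).trans_eq ?_)
    ring

theorem StepBound.smul (hT : StepBound T K) (c : ℂ) : StepBound (c • T) (‖c‖ * K) where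
  atMost N ψ h l hl := by
    change c • (T ψ : Fock D m) l = 0
    rw [hT.atMost N ψ h l hl, smul_zero]
  norm_le N ψ h := by
    rw [LinearMap.smul_apply, norm_smul]
    calc ‖c‖ * ‖T ψ‖ ≤ ‖c‖ * ((N + 1) * K * ‖ψ‖) := by gcongr; exact hT.norm_le N ψ h
      _ = _ := by ring

theorem StepBound.mono (hT : StepBound T K) (h : K ≤ L) : StepBound T L where
  atMost := hT.atMost
  norm_le N ψ hψ := (hT.norm_le N ψ hψ).trans (by gcongr)

theorem IsShift.stepBound {r s : ℕ} {O : ∀ n, NParticle D m (n + s) →ₗ[ℂ] NParticle D m (n + r)}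
    (hT : IsShift O T) (hr : r ≤ 2) (hK : 0 ≤ K) {c : ℕ → ℝ} (hO : ∀ n x, ‖O n x‖ ≤ c n * ‖x‖)
    (hc : ∀ n N : ℕ, n + s ≤ N → c n ≤ (N + 1) * K) : StepBound T K where
  atMost N ψ h l hl := hT.atMost h l (by omega)
  norm_le N ψ h := hT.norm_apply_le h (by positivity) fun n x hn =>
    (hO n x).trans (mul_le_mul_of_nonneg_right (hc n N hn) (norm_nonneg _))

/-- The particle bound is carried through the induction because the factor applied last sees up to
`n + 2k` particles. Its cost `10 (n + 2k + 1) = 20 (k + (n + 1) / 2)` is the step of the Gamma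
function. -/
theorem norm_list_prod_le {k : ℕ} {T : Fin k → Module.End ℂ (FiniteParticle D m)} {K : Fin k → ℝ}
    (hK : ∀ j, 0 ≤ K j) (hT : ∀ j, StepBound (T j) (10 * K j)) {n : ℕ} {ψ : FiniteParticle D m}
    (hψ : AtMost n (ψ : Fock D m)) :
    AtMost (n + 2 * k) ((List.ofFn T).prod ψ : Fock D m) ∧
      ‖(List.ofFn T).prod ψ‖ ≤ 20 ^ k * Real.Gamma (k + ((n : ℝ) + 1) / 2) /
        Real.Gamma (((n : ℝ) + 1) / 2) * (∏ j, K j) * ‖ψ‖ := by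
  have ha : 0 < ((n : ℝ) + 1) / 2 := by positivity
  have hG := Real.Gamma_pos_of_pos ha
  induction k with
  | zero =>
    simp only [List.ofFn_zero, List.prod_nil, Module.End.one_apply, mul_zero, add_zero, pow_zero,
      one_mul, Nat.cast_zero, zero_add, Finset.univ_eq_empty, Finset.prod_empty, mul_one]
    exact ⟨hψ, by rw [div_self hG.ne', one_mul]⟩
  | succ k ih =>
    obtain ⟨ih1, ih2⟩ := ih (fun j => hK j.succ) (fun j => hT j.succ)
    rw [List.ofFn_succ, List.prod_cons, Module.End.mul_apply]
    refine ⟨fun l hl => (hT 0).atMost _ _ ih1 l (by omega), ?_⟩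
    refine ((hT 0).norm_le _ _ ih1).trans ?_
    have hk : 0 < (k : ℝ) + ((n : ℝ) + 1) / 2 := by positivity
    have hGk : Real.Gamma (((k + 1 : ℕ) : ℝ) + ((n : ℝ) + 1) / 2)
        = (k + ((n : ℝ) + 1) / 2) * Real.Gamma (k + ((n : ℝ) + 1) / 2) := by
      rw [← Real.Gamma_add_one hk.ne']
      congr 1
      push_cast
      ring
    have hK0 := hK 0
    calc _ ≤ (((n + 2 * k : ℕ) : ℝ) + 1) * (10 * K 0) *
          (20 ^ k * Real.Gamma (k + ((n : ℝ) + 1) / 2) / Real.Gamma (((n : ℝ) + 1) / 2) *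
            (∏ j : Fin k, K j.succ) * ‖ψ‖) := by gcongr
      _ = _ := by
        rw [hGk, Fin.prod_univ_succ]
        push_cast
        field_simp
        ring

/-- At radius `1 / (40 K)` the factor `20 K` becomes `1 / 2`, and the ratio test applies. The radius
does not depend on `ψ`. -/
theorem summable_analytic_of_stepBound (hK : 0 < K) (hT : StepBound T (10 * K))
    (ψ : FiniteParticle D m) :
    Summable fun k : ℕ => (1 / (40 * K)) ^ k / k.factorial * ‖((T ^ k) ψ : Fock D m)‖ := by
  obtain ⟨n, hn⟩ := ψ.2
  set a : ℝ := ((n : ℝ) + 1) / 2 with ha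
  have ha0 : 0 < a := by positivity
  have hpos : ∀ k : ℕ, 0 < (1 / 2 : ℝ) ^ k * (Real.Gamma (k + a) / k.factorial) := fun k => by
    have : 0 < Real.Gamma (k + a) := Real.Gamma_pos_of_pos (by positivity)
    positivity
  have hs : Summable fun k : ℕ => (1 / 2 : ℝ) ^ k * (Real.Gamma (k + a) / k.factorial) := by
    refine summable_of_ratio_test_tendsto_lt_one (l := 1 / 2) (by norm_num)
      (Filter.Eventually.of_forall fun k => (hpos k).ne') ?_
    -- This is the quotient `(k + a) / (2 (k + 1))` of consecutive terms.
    have ht : Filter.Tendsto (fun k : ℕ => 1 / 2 + (a - 1) / 2 * (1 / ((k : ℝ) + 1))) Filter.atTop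
        (nhds (1 / 2 + (a - 1) / 2 * 0)) :=
      (tendsto_one_div_add_atTop_nhds_zero_nat.const_mul _).const_add _
    rw [mul_zero, add_zero] at ht
    refine ht.congr fun k => ?_
    have hka : (k : ℝ) + a ≠ 0 := by positivity
    have hG : 0 < Real.Gamma (k + a) := Real.Gamma_pos_of_pos (by positivity)
    have hGk : Real.Gamma (((k + 1 : ℕ) : ℝ) + a) = (k + a) * Real.Gamma (k + a) := by
      rw [← Real.Gamma_add_one hka]
      congr 1
      push_cast
      ring
    rw [Real.norm_of_nonneg (hpos _).le, Real.norm_of_nonneg (hpos _).le, hGk, Nat.factorial_succ,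
      pow_succ]
    push_cast
    have : (k.factorial : ℝ) ≠ 0 := by exact_mod_cast k.factorial_ne_zero
    field_simp
    ring
  refine Summable.of_nonneg_of_le (fun k => by positivity) (fun k => ?_)
    (hs.mul_right (‖(ψ : Fock D m)‖ / Real.Gamma a))
  have hb := (norm_list_prod_le (k := k) (T := fun _ => T) (K := fun _ => K) (fun _ => hK.le)
    (fun _ => hT) hn).2
  rw [List.ofFn_const, List.prod_replicate, Finset.prod_const, Finset.card_univ, Fintype.card_fin,
    ← ha] at hb
  have hGa := Real.Gamma_pos_of_pos ha0
  calc (1 / (40 * K)) ^ k / k.factorial * ‖((T ^ k) ψ : Fock D m)‖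
      ≤ (1 / (40 * K)) ^ k / k.factorial *
        (20 ^ k * Real.Gamma (k + a) / Real.Gamma a * K ^ k * ‖(ψ : Fock D m)‖) := by
        gcongr
        exact hb
    _ = (1 / (40 * K) * 20 * K) ^ k * (Real.Gamma (k + a) / k.factorial) *
        (‖(ψ : Fock D m)‖ / Real.Gamma a) := by
        rw [mul_pow, mul_pow]
        ring
    _ = _ := by
        congr 3
        field_simp
        norm_num

theorem isEssentiallySelfAdjoint_of_stepBound
    (hsymm : ∀ ψ φ : FiniteParticle D m,
      ⟪(T ψ : Fock D m), (φ : Fock D m)⟫_ℂ = ⟪(ψ : Fock D m), (T φ : Fock D m)⟫_ℂ)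
    (hK : 0 < K) (hT : StepBound T (10 * K)) : IsEssentiallySelfAdjoint (toPMap T) :=
  isEssentiallySelfAdjoint_of_deficiency (dense_finiteParticle D m) (fun ψ φ => hsymm ψ φ)
    fun _ _ hε hφ => eq_zero_of_inner_eq_mul_inner (dense_finiteParticle D m) hsymm
      (t := 1 / (40 * K)) (by positivity) (summable_analytic_of_stepBound hK hT) hε hφ

end StepBound

/-! ### Formal adjoints on a common domain -/

section FormalAdjoints

variable {H : Type*} [NormedAddCommGroup H] [InnerProductSpace ℂ H] {F : Submodule ℂ H}
  {A A' B B' : Module.End ℂ F}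

/-- `A` and `A'` are formal adjoints of each other on `F`. -/
def FormalAdjoints (A A' : Module.End ℂ F) : Prop :=
  ∀ x y : F, ⟪(A x : H), (y : H)⟫_ℂ = ⟪(x : H), (A' y : H)⟫_ℂ

theorem FormalAdjoints.add (hA : FormalAdjoints A A') (hB : FormalAdjoints B B') :
    FormalAdjoints (A + B) (A' + B') := fun x y => by
  rw [LinearMap.add_apply, LinearMap.add_apply, Submodule.coe_add, Submodule.coe_add,
    inner_add_left, inner_add_right, hA, hB]

theorem FormalAdjoints.smul (hA : FormalAdjoints A A') {c : ℂ} (hc : conj c = c) :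
    FormalAdjoints (c • A) (c • A') := fun x y => by
  rw [LinearMap.smul_apply, LinearMap.smul_apply, Submodule.coe_smul, Submodule.coe_smul,
    inner_smul_left, inner_smul_right, hA, hc]

end FormalAdjoints

/-! ### The field and the Wick square -/

section Operators

variable {D : ℕ} {m : ℝ}

theorem wave_add (ψ φ : Fock D m) (n : ℕ) :
    wave (ψ + φ) n =ᵐ[shellPi D m n] fun P => wave ψ n P + wave φ n P :=
  Lp.coeFn_add _ _

theorem wave_smul (c : ℂ) (ψ : Fock D m) (n : ℕ) :
    wave (c • ψ) n =ᵐ[shellPi D m n] fun P => c * wave ψ n P :=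
  Lp.coeFn_smul c _

/-- Existence of the operator `2^{-1/2} ∫ [v(p) a(p) + u(p) a†(p)] dμ(p)`. -/
theorem exists_field {u v : Momentum D → ℂ} {Cu Cv : ℝ≥0} (hu : StronglyMeasurable u)
    (hv : StronglyMeasurable v)
    (hCu : ∫⁻ x, ‖u x‖ₑ ^ 2 ∂(shellMeasure D m) ≤ (Cu : ℝ≥0∞) ^ 2)
    (hCv : ∫⁻ x, ‖v x‖ₑ ^ 2 ∂(shellMeasure D m) ≤ (Cv : ℝ≥0∞) ^ 2) :
    ∃ T : Module.End ℂ (FiniteParticle D m),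
      (∀ (ψ : FiniteParticle D m) (n : ℕ), wave (T ψ : Fock D m) n =ᵐ[shellPi D m n] fun P =>
        (Real.sqrt 2 : ℂ)⁻¹ * (annTerm v (ψ : Fock D m) n P + creTerm u (ψ : Fock D m) n P)) ∧
      StepBound T (Cu + Cv) ∧
      ((∀ x, v x = conj (u x)) → FormalAdjoints T T) := by
  have ku := isBoundedKernel_column hu hCu
  have kv := isBoundedKernel_row hv hCv
  obtain ⟨A, hA⟩ := exists_isShift (r := 0) (s := 1)
    (fun n => (extractOne D m n).normOp (extractNone D m n) kv)
  obtain ⟨B, hB⟩ := exists_isShift (r := 1) (s := 0)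
    (fun n => (extractNone D m n).normOp (extractOne D m n) ku)
  have hsqrt : ∀ n N : ℕ, n ≤ N → √((n : ℝ) + 1) ≤ N + 1 := fun n N hn => by
    have h1 : (n : ℝ) ≤ N := by exact_mod_cast hn
    exact Real.sqrt_le_iff.mpr ⟨by positivity, by nlinarith⟩
  have hbA : StepBound A Cv := by
    refine hA.stepBound (by norm_num) Cv.2
      (fun n x => (extractOne D m n).norm_normOp_le (extractNone D m n) kv x) fun n N hn => ?_
    simp only [Fintype.card_fin, Fintype.card_unit, Nat.cast_one, Real.sqrt_one, mul_one]
    push_cast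
    exact mul_le_mul_of_nonneg_right (hsqrt n N (by omega)) Cv.2
  have hbB : StepBound B Cu := by
    refine hB.stepBound (by norm_num) Cu.2
      (fun n x => (extractNone D m n).norm_normOp_le (extractOne D m n) ku x) fun n N hn => ?_
    simp only [Fintype.card_fin, Fintype.card_unit, Nat.cast_one, Real.sqrt_one, one_mul]
    push_cast
    exact mul_le_mul_of_nonneg_right (hsqrt n N (by omega)) Cu.2
  refine ⟨(Real.sqrt 2 : ℂ)⁻¹ • (A + B), fun ψ n => ?_, ?_, fun huv => ?_⟩
  · filter_upwards [wave_smul (Real.sqrt 2 : ℂ)⁻¹ ((A ψ : Fock D m) + (B ψ : Fock D m)) n,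
      wave_add (A ψ : Fock D m) (B ψ : Fock D m) n, wave_annOp kv hA ψ n, wave_creOp ku hB ψ n]
      with P h1 h2 h3 h4
    refine h1.trans ?_
    rw [h2, h3, h4]
  · refine ((hbA.add hbB).smul _).mono ?_
    rw [norm_inv, Complex.norm_of_nonneg (Real.sqrt_nonneg 2), add_comm]
    refine mul_le_of_le_one_left (by positivity) (inv_le_one_of_one_le₀ ?_)
    exact Real.one_le_sqrt.mpr (by norm_num)
  · have hAB : FormalAdjoints A B := hA.inner_left hB fun n x y =>
      (extractOne D m n).inner_normOp_left (extractNone D m n) kv ku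
        (fun x _ => by rw [huv, Complex.conj_conj]) x y
    have hBA : FormalAdjoints B A := hB.inner_left hA fun n x y =>
      (extractNone D m n).inner_normOp_left (extractOne D m n) ku kv
        (fun _ x => huv x) x y
    have hsum : FormalAdjoints (A + B) (A + B) := by
      have h1 := FormalAdjoints.add hAB hBA
      rwa [add_comm B A] at h1
    exact hsum.smul (by rw [map_inv₀, Complex.conj_ofReal])

/-- Existence of the Wick square. -/
theorem exists_wickSquare (hD : 1 ≤ D) (hm : 0 < m) (h : SchwartzMap (Spacetime D) ℂ) :
    ∃ T : Module.End ℂ (FiniteParticle D m), IsWickSquare h T ∧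
      StepBound T (pairNorm m h (-1) + cConst m h + pairNorm m h 1) ∧
      ((∀ x, (h x).im = 0) → FormalAdjoints T T) := by
  have ka := isBoundedKernel_annAnnKernel hm h
  have kb := isBoundedKernel_creAnnKernel hD hm h
  have kc := isBoundedKernel_creCreKernel hm h
  obtain ⟨A, hA⟩ := exists_isShift (r := 0) (s := 2)
    (fun n => (extractTwo D m n).normOp (extractNone D m n) ka)
  obtain ⟨B, hB⟩ := exists_isShift (r := 1) (s := 1)
    (fun n => (extractOne D m n).normOp (extractOne D m n) kb)
  obtain ⟨C, hC⟩ := exists_isShift (r := 2) (s := 0)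
    (fun n => (extractNone D m n).normOp (extractTwo D m n) kc)
  have pa := pairNorm_nonneg m h (-1)
  have pb := cConst_nonneg hm h
  have pc := pairNorm_nonneg m h 1
  -- The factor `2` is undone by the `1 / 2` in front of the Wick square.
  have hsqrt : ∀ n N : ℕ, n ≤ N → √(((n : ℝ) + 2) * (n + 1)) ≤ (N + 1) * 2 := fun n N hn => by
    have h1 : (n : ℝ) ≤ N := by exact_mod_cast hn
    have h0 : (0 : ℝ) ≤ n := Nat.cast_nonneg n
    exact Real.sqrt_le_iff.mpr ⟨by positivity, by nlinarith⟩
  have hbA : StepBound A (2 * pairNorm m h (-1)) := by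
    refine hA.stepBound (by norm_num) (by positivity)
      (fun n x => (extractTwo D m n).norm_normOp_le (extractNone D m n) ka x) fun n N hn => ?_
    simp only [Fintype.card_prod, Fintype.card_fin, Fintype.card_unit, Nat.cast_one, Real.sqrt_one,
      mul_one, Real.coe_toNNReal _ pa, ← mul_assoc]
    push_cast
    exact mul_le_mul_of_nonneg_right (hsqrt n N (by omega)) pa
  have hbB : StepBound B (cConst m h) := by
    refine hB.stepBound (by norm_num) (by positivity)
      (fun n x => (extractOne D m n).norm_normOp_le (extractOne D m n) kb x) fun n N hn => ?_
    have h1 : (n : ℝ) + 1 ≤ N := by exact_mod_cast hn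
    rw [Fintype.card_fin, Real.mul_self_sqrt (Nat.cast_nonneg _), Real.coe_toNNReal _ pb]
    refine mul_le_mul_of_nonneg_right ?_ pb
    push_cast
    linarith
  have hbC : StepBound C (2 * pairNorm m h 1) := by
    refine hC.stepBound le_rfl (by positivity)
      (fun n x => (extractNone D m n).norm_normOp_le (extractTwo D m n) kc x) fun n N hn => ?_
    simp only [Fintype.card_prod, Fintype.card_fin, Fintype.card_unit, Nat.cast_one, Real.sqrt_one,
      one_mul, Real.coe_toNNReal _ pc, ← mul_assoc]
    push_cast
    exact mul_le_mul_of_nonneg_right (hsqrt n N (by omega)) pc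
  refine ⟨(1 / 2 : ℂ) • (A + (2 : ℂ) • B + C), fun ψ n => ?_, ?_, fun hreal => ?_⟩
  · filter_upwards [wave_smul (1 / 2 : ℂ)
        ((A ψ : Fock D m) + (2 : ℂ) • (B ψ : Fock D m) + (C ψ : Fock D m)) n,
      wave_add ((A ψ : Fock D m) + (2 : ℂ) • (B ψ : Fock D m)) (C ψ : Fock D m) n,
      wave_add (A ψ : Fock D m) ((2 : ℂ) • (B ψ : Fock D m)) n,
      wave_smul (2 : ℂ) (B ψ : Fock D m) n, wave_annAnnOp ka hA ψ n, wave_creAnnOp kb hB ψ n,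
      wave_creCreOp kc hC ψ n] with P h1 h2 h3 h4 h5 h6 h7
    refine h1.trans ?_
    rw [h2, h3, h4, h5, h6, h7]
  · refine (((hbA.add (hbB.smul 2)).add hbC).smul _).mono (le_of_eq ?_)
    norm_num
    ring
  · have hAC : FormalAdjoints A C := hA.inner_left hC fun n x y =>
      (extractTwo D m n).inner_normOp_left (extractNone D m n) ka kc (fun z _ => by
        simp only [creCreKernel, annAnnKernel]
        rw [conj_fourierM hreal]
        congr 1
        · ring
        · abel) x y
    have hCA : FormalAdjoints C A := hC.inner_left hA fun n x y =>
      (extractNone D m n).inner_normOp_left (extractTwo D m n) kc ka (fun _ z => by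
        simp only [creCreKernel, annAnnKernel]
        rw [conj_fourierM hreal]
        congr 1
        · ring
        · abel) x y
    have hBB : FormalAdjoints B B := hB.inner_left hB fun n x y =>
      (extractOne D m n).inner_normOp_left (extractOne D m n) kb kb (fun p q => by
        simp only [creAnnKernel]
        rw [conj_fourierM hreal, neg_sub, neg_sub]) x y
    have hsum : FormalAdjoints (A + (2 : ℂ) • B + C) (A + (2 : ℂ) • B + C) := by
      have h1 := (hAC.add (hBB.smul (c := 2) (map_ofNat _ 2))).add hCA
      rwa [show C + (2 : ℂ) • B + A = A + (2 : ℂ) • B + C by abel] at h1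
    exact hsum.smul (by rw [map_div₀, map_one, map_ofNat])

theorem lintegral_enorm_sq_coeFn (u : OneParticle D m) :
    ∫⁻ x, ‖u x‖ₑ ^ 2 ∂(shellMeasure D m) = (‖u‖₊ : ℝ≥0∞) ^ 2 := by
  rw [← eLpNorm_two_sq, ← enorm_eq_nnnorm, Lp.enorm_def]

theorem isField_field (f : Smearing D m) : IsField f (field f) := by
  obtain ⟨T, hT, -, -⟩ := exists_field (Lp.stronglyMeasurable f.1) (Lp.stronglyMeasurable f.2)
    (lintegral_enorm_sq_coeFn f.1).le (lintegral_enorm_sq_coeFn f.2).le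
  exact Classical.epsilon_spec (p := IsField f) ⟨T, hT⟩

theorem stepBound_field (f : Smearing D m) : StepBound (field f) (‖f.1‖ + ‖f.2‖) := by
  obtain ⟨T, hT, hb, -⟩ := exists_field (Lp.stronglyMeasurable f.1) (Lp.stronglyMeasurable f.2)
    (lintegral_enorm_sq_coeFn f.1).le (lintegral_enorm_sq_coeFn f.2).le
  rw [(isField_field f).unique (S := T) hT]
  exact hb

theorem isWickSquare_wickSquare (hD : 1 ≤ D) (hm : 0 < m) (h : SchwartzMap (Spacetime D) ℂ) :
    IsWickSquare h (wickSquare m h) := by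
  obtain ⟨T, hT, -, -⟩ := exists_wickSquare hD hm h
  exact Classical.epsilon_spec (p := IsWickSquare h) ⟨T, hT⟩

theorem stepBound_wickSquare (hD : 1 ≤ D) (hm : 0 < m) (h : SchwartzMap (Spacetime D) ℂ) :
    StepBound (wickSquare m h) (pairNorm m h (-1) + cConst m h + pairNorm m h 1) := by
  obtain ⟨T, hT, hb, -⟩ := exists_wickSquare hD hm h
  rw [(isWickSquare_wickSquare hD hm h).unique hT]
  exact hb

/-- Reality holds only almost everywhere, while the adjoint of a kernel is taken pointwise. The
operator is therefore rebuilt from `α f₊` and its exact conjugate, and identified with `α • field f`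
through its wave functions. -/
theorem formalAdjoints_smul_field {f : Smearing D m} {α : ℂ} (hf : (α • f).IsReal) :
    FormalAdjoints (α • field f) (α • field f) := by
  let u : Momentum D → ℂ := fun x => α * f.1 x
  let v : Momentum D → ℂ := fun x => conj (u x)
  have hu : StronglyMeasurable u := (Lp.stronglyMeasurable f.1).const_mul α
  have hv : StronglyMeasurable v := Complex.continuous_conj.comp_stronglyMeasurable hu
  have hCu : ∫⁻ x, ‖u x‖ₑ ^ 2 ∂(shellMeasure D m) = ((‖α‖₊ * ‖f.1‖₊ : ℝ≥0) : ℝ≥0∞) ^ 2 := by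
    simp only [u, enorm_mul, mul_pow]
    rw [lintegral_const_mul' _ _ (by simp), lintegral_enorm_sq_coeFn, ENNReal.coe_mul, mul_pow,
      enorm_eq_nnnorm]
  have hCv : ∫⁻ x, ‖v x‖ₑ ^ 2 ∂(shellMeasure D m) = ((‖α‖₊ * ‖f.1‖₊ : ℝ≥0) : ℝ≥0∞) ^ 2 := by
    rw [← hCu]
    simp only [v, RCLike.enorm_conj]
  obtain ⟨T, hT, -, hsymm⟩ := exists_field hu hv hCu.le hCv.le
  have hvf : ∀ᵐ x ∂(shellMeasure D m), v x = α * f.2 x := by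
    filter_upwards [hf, Lp.coeFn_smul α f.1, Lp.coeFn_smul α f.2] with x h1 h2 h3
    have h4 : (α • f).1 x = α * f.1 x := h2
    have h5 : (α • f).2 x = α * f.2 x := h3
    rw [← h5, h1, h4]
  have hTeq : α • field f = T := by
    refine end_ext fun χ n => ?_
    filter_upwards [wave_smul α (field f χ : Fock D m) n, isField_field f χ n, hT χ n]
      with P h1 h2 h3
    refine h1.trans ?_
    rw [h2, h3, mul_left_comm]
    congr 1
    rw [mul_add]
    congr 1
    · rw [annTerm, annTerm, mul_left_comm, ← integral_const_mul]
      congr 1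
      refine integral_congr_ae ?_
      filter_upwards [hvf] with q hq
      rw [hq, mul_assoc]
    · cases n with
      | zero => simp [creTerm]
      | succ n =>
        simp only [creTerm, u]
        rw [mul_left_comm, Finset.mul_sum]
        simp only [mul_assoc]
  rw [hTeq]
  exact hsymm fun _ => rfl

/-- The Wick square is linear in `h`, so `β` is absorbed into the real test function `β h`. -/
theorem formalAdjoints_smul_wickSquare (hD : 1 ≤ D) (hm : 0 < m) {h : SchwartzMap (Spacetime D) ℂ}
    {β : ℂ} (hh : ∀ x, ((β • h) x).im = 0) :
    FormalAdjoints (β • wickSquare m h) (β • wickSquare m h) := by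
  obtain ⟨T, hT, -, hsymm⟩ := exists_wickSquare hD hm (β • h)
  have hTeq : β • wickSquare m h = T := by
    refine end_ext fun χ n => ?_
    filter_upwards [wave_smul β (wickSquare m h χ : Fock D m) n,
      isWickSquare_wickSquare hD hm h χ n, hT χ n] with P h1 h2 h3
    refine h1.trans ?_
    rw [h2, h3, mul_left_comm]
    congr 1
    rw [mul_add, mul_add]
    congr 1
    · congr 1
      · simp only [annAnnTerm, fourierM_smul, mul_assoc, integral_const_mul]
        ring
      · simp only [creAnnTerm, fourierM_smul, mul_assoc, integral_const_mul]
        rw [← Finset.mul_sum]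
        ring
    · match n with
      | 0 => simp [creCreTerm]
      | 1 => simp [creCreTerm]
      | n + 2 =>
        simp only [creCreTerm, fourierM_smul, mul_assoc]
        simp only [← Finset.mul_sum]
        ring
  rw [hTeq]
  exact hsymm hh

/-! ### The constants -/

theorem KConst_nonneg (f : Smearing D m) (h : SchwartzMap (Spacetime D) ℂ) : 0 ≤ KConst f h :=
  (norm_nonneg f.1).trans ((le_max_left _ _).trans (le_max_left _ _))

/-- Five quantities, each at most `K`, add up to `5 K`, so the constant `10` leaves room. -/
theorem stepBound_field_add_wickSquare (hD : 1 ≤ D) (hm : 0 < m) (f : Smearing D m)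
    (h : SchwartzMap (Spacetime D) ℂ) :
    StepBound (field f + wickSquare m h) (10 * KConst f h) := by
  refine ((stepBound_field f).add (stepBound_wickSquare hD hm h)).mono ?_
  have h1 : ‖f.1‖ ≤ KConst f h := (le_max_left _ _).trans (le_max_left _ _)
  have h2 : ‖f.2‖ ≤ KConst f h := (le_max_right _ _).trans (le_max_left _ _)
  have h3 : cConst m h ≤ KConst f h := (le_max_left _ _).trans (le_max_right _ _)
  have h4 : pairNorm m h 1 ≤ KConst f h :=
    (le_max_left _ _).trans ((le_max_right _ _).trans (le_max_right _ _))
  have h5 : pairNorm m h (-1) ≤ KConst f h :=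
    (le_max_right _ _).trans ((le_max_right _ _).trans (le_max_right _ _))
  have h6 := KConst_nonneg f h
  linarith

theorem cConst_smul_le (hm : 0 < m) (h : SchwartzMap (Spacetime D) ℂ) {β : ℝ} (hβ : 0 ≤ β) :
    cConst m ((β : ℂ) • h) ≤ β * cConst m h := by
  refine Real.sSup_le ?_ (mul_nonneg hβ (cConst_nonneg hm h))
  rintro y ⟨p, k, s, t, rfl⟩
  rw [fourierM_smul, norm_mul, Complex.norm_of_nonneg hβ, mul_left_comm]
  exact mul_le_mul_of_nonneg_left (le_csSup (bddAbove_cConst hm h) ⟨p, k, s, t, rfl⟩) hβ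

theorem pairNorm_smul (m : ℝ) (h : SchwartzMap (Spacetime D) ℂ) {β : ℝ} (hβ : 0 ≤ β) (s : ℤˣ) :
    pairNorm m ((β : ℂ) • h) s = β * pairNorm m h s := by
  simp only [pairNorm, fourierM_smul, norm_mul, Complex.norm_of_nonneg hβ, mul_pow,
    integral_const_mul]
  rw [Real.sqrt_mul (sq_nonneg β), Real.sqrt_sq hβ]

theorem KConst_smul_le (hm : 0 < m) (f : Smearing D m) (h : SchwartzMap (Spacetime D) ℂ) {α β : ℝ}
    (hα : 0 ≤ α) (hβ : 0 ≤ β) :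
    KConst ((α : ℂ) • f) ((β : ℂ) • h) ≤ max α β * KConst f h := by
  have hM : 0 ≤ max α β := hα.trans (le_max_left _ _)
  have hf : ∀ x : OneParticle D m, ‖x‖ ≤ KConst f h → ‖(α : ℂ) • x‖ ≤ max α β * KConst f h := by
    intro x hx
    rw [norm_smul, Complex.norm_of_nonneg hα]
    exact mul_le_mul (le_max_left _ _) hx (norm_nonneg _) hM
  have hh : ∀ x : ℝ, 0 ≤ x → x ≤ KConst f h → β * x ≤ max α β * KConst f h := fun x hx0 hx =>
    mul_le_mul (le_max_right _ _) hx hx0 hM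
  refine max_le (max_le ?_ ?_) (max_le ?_ (max_le ?_ ?_))
  · exact hf f.1 ((le_max_left _ _).trans (le_max_left _ _))
  · exact hf f.2 ((le_max_right _ _).trans (le_max_left _ _))
  · exact (cConst_smul_le hm h hβ).trans
      (hh _ (cConst_nonneg hm h) ((le_max_left _ _).trans (le_max_right _ _)))
  · rw [pairNorm_smul m h hβ]
    exact hh _ (pairNorm_nonneg m h 1)
      ((le_max_left _ _).trans ((le_max_right _ _).trans (le_max_right _ _)))
  · rw [pairNorm_smul m h hβ]
    exact hh _ (pairNorm_nonneg m h (-1))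
      ((le_max_right _ _).trans ((le_max_right _ _).trans (le_max_right _ _)))

theorem isEssentiallySelfAdjoint_smul_field_add_smul_wickSquare (hD : 1 ≤ D) (hm : 0 < m)
    {f : Smearing D m} {h : SchwartzMap (Spacetime D) ℂ} {α β : ℂ} (hf : (α • f).IsReal)
    (hh : ∀ x, ((β • h) x).im = 0) :
    IsEssentiallySelfAdjoint (toPMap (α • field f + β • wickSquare m h)) := by
  have hb := ((stepBound_field f).smul α).add ((stepBound_wickSquare hD hm h).smul β)
  -- Taking the maximum with `1` keeps the constant positive even when the step bound vanishes.
  exact isEssentiallySelfAdjoint_of_stepBound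
    ((formalAdjoints_smul_field hf).add (formalAdjoints_smul_wickSquare hD hm hh))
    (lt_of_lt_of_le zero_lt_one (le_max_right _ 1)) (hb.mono ((le_max_left _ 1).trans
      (le_mul_of_one_le_left (zero_le_one.trans (le_max_right _ 1)) (by norm_num))))

end Operators

end FreeField

end

open FreeField in
theorem mainTheorem3 (D : ℕ) (hD : 1 ≤ D) (m : ℝ) (hm : 0 < m) :
    -- the field and the Wick square are well defined on the finite-particle subspace
    (∀ f : Smearing D m, IsField f (field f)) ∧
    (∀ h : SchwartzMap (Spacetime D) ℂ, IsWickSquare h (wickSquare m h)) ∧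
    -- the bound
    (∀ (k n : ℕ) (f : Fin k → Smearing D m) (h : Fin k → SchwartzMap (Spacetime D) ℂ)
      (ψ : FiniteParticle D m), AtMost n (ψ : Fock D m) →
      ‖(List.ofFn fun j : Fin k => field (f j) + wickSquare m (h j)).prod ψ‖ ≤
        20 ^ k * Real.Gamma (k + ((n : ℝ) + 1) / 2) / Real.Gamma (((n : ℝ) + 1) / 2) *
          (∏ j, KConst (f j) (h j)) * ‖ψ‖) ∧
    -- the scaling of the constant
    (∀ (f : Smearing D m) (h : SchwartzMap (Spacetime D) ℂ) (α β : ℝ), 0 ≤ α → 0 ≤ β →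
      KConst ((α : ℂ) • f) ((β : ℂ) • h) ≤ max α β * KConst f h) ∧
    -- essential self-adjointness
    (∀ (f : Smearing D m) (h : SchwartzMap (Spacetime D) ℂ) (α β : ℂ),
      (α • f).IsReal → (∀ x, ((β • h) x).im = 0) →
      IsEssentiallySelfAdjoint (toPMap (α • field f + β • wickSquare m h))) :=
  ⟨isField_field, isWickSquare_wickSquare hD hm,
    fun _ _ f h _ hψ => (norm_list_prod_le (fun j => KConst_nonneg (f j) (h j))
      (fun j => stepBound_field_add_wickSquare hD hm (f j) (h j)) hψ).2,
    fun f h _ _ hα hβ => KConst_smul_le hm f h hα hβ,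
    fun _ _ _ _ hf hh => isEssentiallySelfAdjoint_smul_field_add_smul_wickSquare hD hm hf hh⟩
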